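/- Let $\Bbbk$ be an algebraically closed field and $A$ a connected, basic, finite dimensional $\Bbbk$-algebra with a decomposition $1=e_1+\dots+e_n$ into pairwise orthogonal primitive idempotents. Let $\mathcal{C}$ be a small category equivalent to the category $A$-mod of finitely generated left $A$-modules, and let $\mathscr{C}_A$ be the $2$-category with one object $\mathtt{i}$ (identified with $\mathcal{C}$), whose $1$-morphisms are the endofunctors of $\mathcal{C}$ isomorphic to tensoring over $A$ with an $A$-$A$-bimodule from the additive closure of $A$ and $A\otimes_{\Bbbk}A$, and whose $2$-morphisms are all natural transformations. Let $\mathrm{F}_{ij}$ be a $1$-morphism isomorphic to tensoring with $Ae_i\otimes_{\Bbbk}e_jA$, and let $\mathrm{F}=\bigoplus_{i,j=1}^n\mathrm{F}_{ij}$. A finitary $2$-representation $\mathbf{M}$ of $\mathscr{C}_A$ is a strict $\Bbbk$-linear $2$-functor that sends $\mathtt{i}$ to an additive, idempotent split, Krull-Schmidt, $\Bbbk$-linear category $\mathbf{M}(\mathtt{i})$ with finitely many isomorphism classes of indecomposable objects and finite dimensional morphism spaces, and sends $1$-morphisms to additive $\Bbbk$-linear functors. It is simple transitive if for all indecomposable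 $X,Y\in\mathbf{M}(\mathtt{i})$ there is a $1$-morphism $\mathrm{G}$ such that $Y$ is isomorphic to a direct summand of $\mathbf{M}(\mathrm{G})X$, and if $\mathbf{M}(\mathtt{i})$ has no non-zero proper two-sided ideal that is stable under all $\mathbf{M}(\mathrm{G})$. The abelianization $\overline{\mathbf{M}}(\mathtt{i})$ is the category whose objects are the morphisms $\eta\colon X\to Y$ of $\mathbf{M}(\mathtt{i})$ and whose morphisms from $\eta\colon X\to Y$ to $\eta'\colon X'\to Y'$ are the commutative squares, modulo those squares whose component $Y\to Y'$ factors through $\eta'$; each $1$-morphism $\mathrm{G}$ acts on it componentwise by a functor $\overline{\mathbf{M}}(\mathrm{G})$. Assume that there exist $s,t\in\{1,\dots,n\}$ such that the left $A$-modules $Ae_s$ and $\mathrm{Hom}_{\Bbbk}(e_tA,\Bbbk)$ are isomorphic. Then for every simple transitive finitary $2$-representation $\mathbf{M}$ of $\mathscr{C}_A$, the functor $\overline{\mathbf{M}}(\mathrm{F})$ is exact. -/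

import Mathlib

open CategoryTheory CategoryTheory.Limits
open scoped TensorProduct ModuleCat

universe uk u vC uC v w

/-- An `A`-`A`-bimodule over the field `k` (on which `k` acts centrally); a right action of `A`
is a left action of `Aᵐᵒᵖ`. -/
structure AlgBimod (k : Type uk) (A : Type u) [Field k] [Ring A] [Algebra k A] where
  carrier : Type u
  [addCommGroup : AddCommGroup carrier]
  [moduleBase : Module k carrier]
  [moduleLeft : Module A carrier]
  [moduleRight : Module Aᵐᵒᵖ carrier]
  [towerLeft : IsScalarTower k A carrier]
  [towerRight : IsScalarTower k Aᵐᵒᵖ carrier]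
  [comm : SMulCommClass A Aᵐᵒᵖ carrier]

namespace AlgBimod

variable {k : Type uk} {A : Type u} [Field k] [Ring A] [Algebra k A]

instance : CoeSort (AlgBimod k A) (Type u) := ⟨AlgBimod.carrier⟩

attribute [instance] addCommGroup moduleBase moduleLeft moduleRight towerLeft towerRight comm

/-- Homomorphisms of bimodules. -/
structure Hom (W V : AlgBimod k A) extends W →ₗ[A] V where
  map_rsmul : ∀ (b : Aᵐᵒᵖ) (w : W), toFun (b • w) = b • toFun w

/-- A left module with a right action by left-linear maps is a bimodule. -/
def ofAction (T : Type u) [AddCommGroup T] [Module k T] [Module A T] [IsScalarTower k A T]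
    (φ : Aᵐᵒᵖ →ₐ[k] Module.End A T) : AlgBimod k A :=
  letI : Module Aᵐᵒᵖ T := Module.compHom T φ.toRingHom
  { carrier := T
    towerRight := ⟨fun c b t => by
      change φ (c • b) t = c • φ b t
      rw [map_smul]; rfl⟩
    comm := ⟨fun a b t => ((φ b).map_smul a t).symm⟩ }

variable (k A) in
/-- The regular bimodule `A`. -/
def regular : AlgBimod k A where
  carrier := A

/-- The bimodule `P ⊗ Q` (tensor product over `k`), where `P` is a left module and `Q` is
a right module. -/
noncomputable def outer (P Q : Type u) [AddCommGroup P] [Module k P] [Module A P]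
    [IsScalarTower k A P] [AddCommGroup Q] [Module k Q] [Module Aᵐᵒᵖ Q]
    [IsScalarTower k Aᵐᵒᵖ Q] : AlgBimod k A :=
  ofAction (k := k) (P ⊗[k] Q)
    (AlgHom.ofLinearMap
      { toFun := fun b => TensorProduct.AlgebraTensorModule.lTensor A P (Algebra.lsmul k k Q b)
        map_add' := fun b c => by ext; simp
        map_smul' := fun c b => by ext; simp }
      (by ext; simp)
      (fun b c => by ext; simp))

section Tensor

variable (W : AlgBimod k A) (X : Type u) [AddCommGroup X] [Module A X]

/-- The left submodule generated by all `wa ⊗ x - w ⊗ ax`. -/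
def balanced : Submodule A (W ⊗[ℤ] X) :=
  Submodule.span A
    {z | ∃ (w : W) (a : A) (x : X), z = (MulOpposite.op a • w) ⊗ₜ[ℤ] x - w ⊗ₜ[ℤ] (a • x)}

/-- The left `A`-module `W ⊗_A X`: the quotient of the tensor product of abelian groups by the
relations `wa ⊗ x = w ⊗ ax`. -/
def Tensor : Type u := (W ⊗[ℤ] X) ⧸ balanced W X

noncomputable instance : AddCommGroup (Tensor W X) :=
  inferInstanceAs (AddCommGroup ((W ⊗[ℤ] X) ⧸ balanced W X))

noncomputable instance : Module A (Tensor W X) :=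
  inferInstanceAs (Module A ((W ⊗[ℤ] X) ⧸ balanced W X))

noncomputable instance : Module k (Tensor W X) :=
  inferInstanceAs (Module k ((W ⊗[ℤ] X) ⧸ balanced W X))

instance : IsScalarTower k A (Tensor W X) :=
  inferInstanceAs (IsScalarTower k A ((W ⊗[ℤ] X) ⧸ balanced W X))

variable {X}

/-- The element `w ⊗ x` of `W ⊗_A X`. -/
def tmk (w : W) (x : X) : Tensor W X := (balanced W X).mkQ (w ⊗ₜ[ℤ] x)

variable {W}

lemma tmk_rsmul (a : A) (w : W) (x : X) :
    tmk W (MulOpposite.op a • w) x = tmk W w (a • x) :=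
  (Submodule.Quotient.eq _).2 (Submodule.subset_span ⟨w, a, x, rfl⟩)

lemma smul_tmk (a : A) (w : W) (x : X) : a • tmk W w x = tmk W (a • w) x := rfl

lemma tmk_add (w : W) (x y : X) : tmk W w (x + y) = tmk W w x + tmk W w y := by
  simp only [tmk, TensorProduct.tmul_add, map_add]; rfl

lemma add_tmk (w v : W) (x : X) : tmk W (w + v) x = tmk W w x + tmk W v x := by
  simp only [tmk, TensorProduct.add_tmul, map_add]; rfl

lemma tmk_zero (w : W) : tmk W w (0 : X) = 0 := by
  simpa using tmk_add w (0 : X) 0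

lemma zero_tmk (x : X) : tmk W 0 x = 0 := by
  simpa using add_tmk (0 : W) 0 x

lemma tensor_induction {p : Tensor W X → Prop} (h0 : p 0) (hmk : ∀ w x, p (tmk W w x))
    (hadd : ∀ y z, p y → p z → p (y + z)) (z : Tensor W X) : p z := by
  obtain ⟨z, rfl⟩ := Submodule.mkQ_surjective _ z
  induction z using TensorProduct.induction_on with
  | zero => rw [map_zero]; exact h0
  | tmul w x => exact hmk w x
  | add y z hy hz => rw [map_add]; exact hadd _ _ hy hz

lemma tensor_addHom_ext {Z : Type*} [AddCommGroup Z] {f g : Tensor W X →+ Z}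
    (h : ∀ w x, f (tmk W w x) = g (tmk W w x)) : f = g := by
  ext z
  induction z using tensor_induction with
  | h0 => simp
  | hmk w x => exact h w x
  | hadd y z hy hz => simp [hy, hz]

lemma tensor_hom_ext {Z : Type*} [AddCommGroup Z] [Module A Z] {f g : Tensor W X →ₗ[A] Z}
    (h : ∀ w x, f (tmk W w x) = g (tmk W w x)) : f = g :=
  LinearMap.toAddMonoidHom_injective (tensor_addHom_ext h)

/-- The universal property of `W ⊗_A X`: balanced biadditive maps. -/
noncomputable def tliftAdd {Z : Type*} [AddCommGroup Z] (f : W →+ X →+ Z)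
    (hf : ∀ (a : A) w x, f (MulOpposite.op a • w) x = f w (a • x)) : Tensor W X →+ Z :=
  QuotientAddGroup.lift (balanced W X).toAddSubgroup
    (TensorProduct.liftAddHom f (fun c w x => by
      rw [map_zsmul, map_zsmul, AddMonoidHom.smul_apply]))
    (by
      intro z hz
      change z ∈ Submodule.span A _ at hz
      rw [AddMonoidHom.mem_ker]
      induction hz using Submodule.closure_induction with
      | zero => simp
      | add y z _ _ hy hz => rw [map_add, hy, hz, add_zero]
      | smul_mem b z hz =>
        obtain ⟨w, a, x, rfl⟩ := hz
        rw [smul_sub, TensorProduct.smul_tmul', TensorProduct.smul_tmul', map_sub,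
          TensorProduct.liftAddHom_tmul, TensorProduct.liftAddHom_tmul, ← hf, smul_comm,
          sub_self])

lemma tliftAdd_tmk {Z : Type*} [AddCommGroup Z] (f : W →+ X →+ Z) (hf) (w : W) (x : X) :
    tliftAdd (A := A) f hf (tmk W w x) = f w x := rfl

/-- The universal property of `W ⊗_A X`: balanced biadditive maps, linear in the left
argument. -/
noncomputable def tlift {Z : Type*} [AddCommGroup Z] [Module A Z] (f : W →+ X →+ Z)
    (hf : ∀ (a : A) w x, f (MulOpposite.op a • w) x = f w (a • x))
    (hl : ∀ (a : A) w x, f (a • w) x = a • f w x) : Tensor W X →ₗ[A] Z where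
  __ := tliftAdd f hf
  map_smul' a z := by
    change tliftAdd f hf (a • z) = a • tliftAdd f hf z
    induction z using tensor_induction with
    | h0 => simp
    | hmk w x => rw [smul_tmk, tliftAdd_tmk, tliftAdd_tmk, hl]
    | hadd y z hy hz => rw [smul_add, map_add, hy, hz, map_add, smul_add]

lemma tlift_tmk {Z : Type*} [AddCommGroup Z] [Module A Z] (f : W →+ X →+ Z) (hf hl)
    (w : W) (x : X) : tlift (A := A) f hf hl (tmk W w x) = f w x := rfl

variable (W) in
/-- `w ⊗ x` as a biadditive map. -/
noncomputable def tmkHom : W →+ X →+ Tensor W X :=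
  AddMonoidHom.mk' (fun w => AddMonoidHom.mk' (tmk W w) (tmk_add w))
    (fun w v => by ext x; exact add_tmk w v x)

variable {V : AlgBimod k A} {Y : Type u} [AddCommGroup Y] [Module A Y]

/-- The map `f ⊗ g : W ⊗_A X → V ⊗_A Y`. -/
noncomputable def tmap (f : Hom W V) (g : X →ₗ[A] Y) : Tensor W X →ₗ[A] Tensor V Y :=
  tlift (((tmkHom V).compl₂ g.toAddMonoidHom).comp f.toLinearMap.toAddMonoidHom)
    (fun a w x => by
      change tmk V (f.toFun _) _ = tmk V (f.toFun _) (g (a • x))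
      rw [f.map_rsmul, tmk_rsmul, map_smul]; rfl)
    (fun a w x => by
      change tmk V (f.toLinearMap _) _ = a • tmk V (f.toLinearMap _) _
      rw [map_smul, smul_tmk])

lemma tmap_tmk (f : Hom W V) (g : X →ₗ[A] Y) (w : W) (x : X) :
    tmap f g (tmk W w x) = tmk V (f.toLinearMap w) (g x) := rfl

/-- The identity homomorphism. -/
def Hom.id (W : AlgBimod k A) : Hom W W := { LinearMap.id with map_rsmul := fun _ _ => rfl }

variable (W V) in
/-- The bimodule `W ⊗_A V`. -/
noncomputable def tensor : AlgBimod k A :=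
  ofAction (k := k) (Tensor W V)
    (AlgHom.ofLinearMap
      { toFun := fun b => tmap (Hom.id W)
          { toFun := fun v => b • v, map_add' := smul_add b, map_smul' := fun a v => (smul_comm a b v).symm }
        map_add' := fun b c => tensor_hom_ext fun w v => by
          change tmk W w ((b + c) • v) = tmk W w (b • v) + tmk W w (c • v)
          rw [add_smul, tmk_add]
        map_smul' := fun c b => tensor_hom_ext fun w v => by
          change tmk W w ((c • b) • v) = c • tmk W w (b • v)
          rw [smul_assoc, ← algebraMap_smul A c, ← algebraMap_smul A c, ← tmk_rsmul, smul_tmk,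
            ← MulOpposite.algebraMap_apply, algebraMap_smul, algebraMap_smul] }
      (tensor_hom_ext fun w v => by
          change tmk W w ((1 : Aᵐᵒᵖ) • v) = tmk W w v
          rw [one_smul])
      (fun b c => tensor_hom_ext fun w v => by
          change tmk W w ((b * c) • v) = tmk W w (b • c • v)
          rw [mul_smul]))

end Tensor

/-- The functor `W ⊗_A _` on left `A`-modules. -/
noncomputable def tensorFunctor (W : AlgBimod k A) : ModuleCat.{u} A ⥤ ModuleCat.{u} A where
  obj X := ModuleCat.of A (Tensor W X)
  map f := ModuleCat.ofHom (tmap (Hom.id W) f.hom)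
  map_id X := by
    ext z
    exact LinearMap.congr_fun (tensor_hom_ext (f := tmap (Hom.id W) LinearMap.id)
      (g := LinearMap.id) fun w x => rfl) z
  map_comp {X Y Z} f g := by
    ext z
    exact LinearMap.congr_fun (tensor_hom_ext (f := tmap (Hom.id W) (g.hom ∘ₗ f.hom))
      (g := tmap (Hom.id W) g.hom ∘ₗ tmap (Hom.id W) f.hom) fun w x => rfl) z

/-- The additive closure of `A` and `A ⊗ A`: the smallest class of bimodules that contains
these two and is closed under finite direct sums and direct summands, hence under isomorphism
(the maps `i x` and `p x` exhibit `W` as a direct summand of `⨁ x, Y x`). -/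
inductive AddClosure : AlgBimod k A → Prop
  | regular : AddClosure (regular k A)
  | free : AddClosure (outer A A)
  | summand {W : AlgBimod k A} {m : ℕ} (Y : Fin m → AlgBimod k A) (hY : ∀ x, AddClosure (Y x))
      (i : ∀ x, Hom W (Y x)) (p : ∀ x, Hom (Y x) W)
      (h : ∀ w, ∑ x, (p x).toLinearMap ((i x).toLinearMap w) = w) : AddClosure W

section Closure

lemma AddClosure.of_retract {W V : AlgBimod k A} (hV : AddClosure V) (i : Hom W V) (p : Hom V W)
    (h : ∀ w, p.toLinearMap (i.toLinearMap w) = w) : AddClosure W :=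
  .summand (m := 1) (fun _ => V) (fun _ => hV) (fun _ => i) (fun _ => p) (by simpa using h)

lemma AddClosure.summand_of_eq {W : AlgBimod k A} {m : ℕ} (Y : Fin m → AlgBimod k A)
    (hY : ∀ x, AddClosure (Y x)) (i : ∀ x, Hom W (Y x)) (p : ∀ x, Hom (Y x) W)
    (h : (∑ x, (p x).toLinearMap ∘ₗ (i x).toLinearMap).toAddMonoidHom = AddMonoidHom.id W) :
    AddClosure W :=
  .summand Y hY i p fun w =>
    (LinearMap.sum_apply _ _ w).symm.trans (DFunLike.congr_fun h w)

variable (k) in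
/-- `A ⊗_A X ≅ X`. -/
noncomputable def regularEquiv (X : Type u) [AddCommGroup X] [Module A X] :
    Tensor (regular k A) X ≃ₗ[A] X :=
  LinearEquiv.ofLinearMap
    (tlift (W := regular k A) (smulAddHom A X)
      (fun a (w : A) x => mul_smul w a x) (fun a (w : A) x => mul_smul a w x))
    { toFun := fun x => tmk (regular k A) (1 : A) x
      map_add' := tmk_add _
      map_smul' := fun a x => by
        refine (tmk_rsmul (W := regular k A) a (1 : A) x).symm.trans ?_
        refine Eq.trans ?_ (smul_tmk (W := regular k A) a (1 : A) x).symm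
        exact congrArg (fun w : A => tmk (regular k A) w x)
          ((one_mul a).trans (mul_one a).symm) }
    (by ext x; exact one_smul A x)
    (tensor_hom_ext fun (w : A) x => by
      refine (tmk_rsmul (W := regular k A) w (1 : A) x).symm.trans ?_
      exact congrArg (fun w : A => tmk (regular k A) w x) (one_mul w))

/-- Tensoring with the regular bimodule is the identity functor. -/
noncomputable def regularIso : tensorFunctor (regular k A) ≅ 𝟭 (ModuleCat.{u} A) :=
  NatIso.ofComponents (fun X => (regularEquiv k X).toModuleIso) (fun {X Y} f => by
    ext z
    exact LinearMap.congr_fun (tensor_hom_ext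
      (f := (regularEquiv k Y).toLinearMap ∘ₗ tmap (Hom.id (regular k A)) f.hom)
      (g := f.hom ∘ₗ (regularEquiv k X).toLinearMap)
      fun (w : A) x => (map_smul f.hom w x).symm) z)

variable (W V : AlgBimod k A)

section
variable (X : Type u) [AddCommGroup X] [Module A X]

/-- The map `w ⊗ v ↦ w ⊗ (v ⊗ x)`. -/
noncomputable def assocAux : X →+ Tensor W V →+ Tensor W (Tensor V X) :=
  AddMonoidHom.mk' (fun x => tliftAdd ((tmkHom W).compl₂ ((tmkHom V).flip x))
      (fun a w v => tmk_rsmul a w (tmk V v x)))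
    (fun x y => tensor_addHom_ext fun w v =>
      (congrArg (tmk W w) (tmk_add v x y)).trans (tmk_add w _ _))

/-- `(W ⊗_A V) ⊗_A X → W ⊗_A (V ⊗_A X)`. -/
noncomputable def assocHom : Tensor (tensor W V) X →ₗ[A] Tensor W (Tensor V X) :=
  tlift (W := tensor W V) (assocAux W V X).flip
    (fun a z x => DFunLike.congr_fun (tensor_addHom_ext
      (f := (assocAux W V X x).comp
        (DistribSMul.toAddMonoidHom (tensor W V) (MulOpposite.op a)))
      (g := assocAux W V X (a • x)) fun w _ => congrArg (tmk W w) (tmk_rsmul a _ x)) z)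
    (fun a z x => DFunLike.congr_fun (tensor_addHom_ext
      (f := (assocAux W V X x).comp (DistribSMul.toAddMonoidHom (tensor W V) a))
      (g := (DistribSMul.toAddMonoidHom _ a).comp (assocAux W V X x)) fun _ _ => rfl) z)

/-- The map `v ⊗ x ↦ (w ⊗ v) ⊗ x`. -/
noncomputable def assocAux' : W →+ Tensor V X →+ Tensor (tensor W V) X :=
  (AddMonoidHom.mk' (fun w => tliftAdd (W := V)
        ((tmkHom (X := X) (tensor W V)).comp (tmkHom (X := V) W w))
        (fun a v x => tmk_rsmul (W := tensor W V) a (tmk W w v) x))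
      (fun w w' => tensor_addHom_ext fun v x =>
        (congrArg (fun z => tmk (tensor W V) z x) (add_tmk w w' v)).trans
          (add_tmk (W := tensor W V) (tmk W w v) (tmk W w' v) x)))

/-- `W ⊗_A (V ⊗_A X) → (W ⊗_A V) ⊗_A X`. -/
noncomputable def assocInv : Tensor W (Tensor V X) →ₗ[A] Tensor (tensor W V) X :=
  tlift (assocAux' W V X)
    (fun a w z => DFunLike.congr_fun (tensor_addHom_ext
      (f := assocAux' W V X (MulOpposite.op a • w))
      (g := (assocAux' W V X w).comp (DistribSMul.toAddMonoidHom _ a))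
      fun v x => congrArg (fun z => tmk (tensor W V) z x) (tmk_rsmul a w v)) z)
    (fun a w z => DFunLike.congr_fun (tensor_addHom_ext
      (f := assocAux' W V X (a • w))
      (g := (DistribSMul.toAddMonoidHom _ a).comp (assocAux' W V X w)) fun _ _ => rfl) z)

/-- `(W ⊗_A V) ⊗_A X ≅ W ⊗_A (V ⊗_A X)`. -/
noncomputable def assocEquiv : Tensor (tensor W V) X ≃ₗ[A] Tensor W (Tensor V X) :=
  LinearEquiv.ofLinearMap (assocHom W V X) (assocInv W V X)
    (tensor_hom_ext fun w z => by
      induction z using tensor_induction with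
      | h0 => simp only [tmk_zero, map_zero]
      | hmk v x => rfl
      | hadd y z hy hz => rw [tmk_add, map_add, map_add, hy, hz])
    (tensor_hom_ext fun z x => by
      induction z using tensor_induction (W := W) (X := V) with
      | h0 =>
        have := zero_tmk (W := tensor W V) x
        exact (congrArg _ this).trans ((map_zero _).trans
          ((congrArg _ this).trans (map_zero _)).symm)
      | hmk w v => rfl
      | hadd y z hy hz =>
        have := add_tmk (W := tensor W V) y z x
        exact (congrArg _ this).trans ((map_add _ _ _).trans
          ((congrArg₂ (· + ·) hy hz).trans ((congrArg _ this).trans (map_add _ _ _)).symm)))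

end

/-- Composition of tensor functors. -/
noncomputable def assocIso : tensorFunctor V ⋙ tensorFunctor W ≅ tensorFunctor (tensor W V) :=
  NatIso.ofComponents (fun X => (assocEquiv W V X).symm.toModuleIso) (fun {X Y} f => by
    ext z
    refine LinearMap.congr_fun (tensor_hom_ext
      (f := assocInv W V Y ∘ₗ tmap (Hom.id W) (tmap (Hom.id V) f.hom))
      (g := tmap (Hom.id (tensor W V)) f.hom ∘ₗ assocInv W V X) fun w z => ?_) z
    induction z using tensor_induction with
    | h0 => simp only [tmk_zero, map_zero]
    | hmk v x => rfl
    | hadd y z hy hz => rw [tmk_add, map_add, map_add, hy, hz])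

variable {W V}

lemma outer_addHom_ext {P Q Z : Type*} [AddCommGroup P] [Module k P] [AddCommGroup Q]
    [Module k Q] [AddCommGroup Z] {f g : P ⊗[k] Q →+ Z}
    (h : ∀ p q, f (p ⊗ₜ q) = g (p ⊗ₜ q)) : f = g := by
  ext z
  induction z using TensorProduct.induction_on with
  | zero => simp
  | tmul p q => exact h p q
  | add y z hy hz => simp [hy, hz]

lemma outer_outer_addHom_ext {P Q R Z : Type*} [AddCommGroup P] [Module k P] [AddCommGroup Q]
    [Module k Q] [AddCommGroup R] [Module k R] [AddCommGroup Z] {f g : P ⊗[k] (Q ⊗[k] R) →+ Z}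
    (h : ∀ p q r, f (p ⊗ₜ (q ⊗ₜ r)) = g (p ⊗ₜ (q ⊗ₜ r))) : f = g :=
  outer_addHom_ext fun p z => by
    induction z using TensorProduct.induction_on with
    | zero => simp
    | tmul q r => exact h p q r
    | add y z hy hz => simp only [TensorProduct.tmul_add, map_add, hy, hz]

lemma freeTensor_addHom_ext {V : AlgBimod k A} {Z : Type*} [AddCommGroup Z]
    {f g : Tensor (outer (k := k) (A := A) A A) V →+ Z}
    (h : ∀ (a b : A) v, f (tmk (outer (k := k) (A := A) A A) (a ⊗ₜ[k] b : A ⊗[k] A) v) =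
      g (tmk (outer (k := k) (A := A) A A) (a ⊗ₜ[k] b : A ⊗[k] A) v)) : f = g :=
  tensor_addHom_ext fun z v => DFunLike.congr_fun (outer_addHom_ext
    (f := f.comp ((tmkHom (outer (k := k) (A := A) A A)).flip v))
    (g := g.comp ((tmkHom (outer (k := k) (A := A) A A)).flip v)) fun a b => h a b v) z

lemma hom_smul_base {V U : AlgBimod k A} (h : V →+ U) (hr : ∀ (b : Aᵐᵒᵖ) v, h (b • v) = b • h v)
    (c : k) (v : V) : h (c • v) = c • h v := by
  rw [← algebraMap_smul Aᵐᵒᵖ c v, hr, algebraMap_smul]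

/-- The linear map `A ⊗ V → U`, `a ⊗ v ↦ a h(v)`. -/
noncomputable def outerLin {V U : AlgBimod k A} (h : V →+ U)
    (hr : ∀ (b : Aᵐᵒᵖ) v, h (b • v) = b • h v) : A ⊗[k] V →ₗ[A] U :=
  TensorProduct.AlgebraTensorModule.lift
    { toFun := fun a =>
        { toFun := fun v => a • h v
          map_add' := fun v w => by rw [map_add, smul_add]
          map_smul' := fun c v => by rw [hom_smul_base h hr, smul_comm]; rfl }
      map_add' := fun a b => by ext v; exact add_smul a b _
      map_smul' := fun a b => by ext v; exact mul_smul a b _ }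

/-- The bimodule map `A ⊗ V → U`, `a ⊗ v ↦ a h(v)`, for a map `h` of right modules. -/
noncomputable def outerLift {V U : AlgBimod k A} (h : V →+ U)
    (hr : ∀ (b : Aᵐᵒᵖ) v, h (b • v) = b • h v) : Hom (outer (k := k) (A := A) A V) U where
  __ := outerLin h hr
  map_rsmul b z := DFunLike.congr_fun (outer_addHom_ext
    (f := (outerLin h hr).toAddMonoidHom.comp
        (DistribSMul.toAddMonoidHom (outer (k := k) (A := A) A V) b))
    (g := (DistribSMul.toAddMonoidHom U b).comp (outerLin h hr).toAddMonoidHom) fun a v =>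
    (congrArg (a • ·) (hr b v)).trans (smul_comm a b (h v))) z

lemma outerLift_tmul {V U : AlgBimod k A} (h : V →+ U) (hr) (a : A) (v : V) :
    (outerLift h hr).toLinearMap (a ⊗ₜ[k] v : A ⊗[k] V) = a • h v := rfl

/-- The map `v ↦ a ⊗ v`. -/
noncomputable def outerMk (V : AlgBimod k A) (a : A) : V →+ outer (k := k) (A := A) A V :=
  (TensorProduct.mk k A V a).toAddMonoidHom

/-- The map `id ⊗ g : A ⊗ V → A ⊗ V'`. -/
noncomputable def outerMap {V V' : AlgBimod k A} (g : Hom V V') :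
    Hom (outer (k := k) (A := A) A V) (outer A V') :=
  outerLift ((outerMk V' 1).comp g.toLinearMap.toAddMonoidHom)
    (fun b v => congrArg (outerMk V' 1) (g.map_rsmul b v))

/-- The map `a ⊗ b ↦ 1 ⊗ λ(a)b` on `A ⊗ A`. -/
noncomputable def contract (l : A →ₗ[k] k) :
    outer (k := k) (A := A) A A →+ outer (k := k) (A := A) A A :=
  (TensorProduct.mk k A A 1 ∘ₗ (TensorProduct.lid k A).toLinearMap ∘ₗ
    l.rTensor A : A ⊗[k] A →ₗ[k] A ⊗[k] A).toAddMonoidHom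

lemma contract_tmul (l : A →ₗ[k] k) (a b : A) :
    contract l (a ⊗ₜ[k] b : A ⊗[k] A) = ((1 : A) ⊗ₜ[k] (l a • b) : A ⊗[k] A) := rfl

lemma outerMap_tmul {V V' : AlgBimod k A} (g : Hom V V') (a : A) (v : V) :
    (outerMap g).toLinearMap (a ⊗ₜ[k] v : A ⊗[k] V) =
      (a ⊗ₜ[k] g.toLinearMap v : A ⊗[k] V') := by
  change (a * 1) ⊗ₜ[k] g.toLinearMap v = _
  rw [mul_one]

lemma AddClosure.free_free [Module.Finite k A] :
    AddClosure (outer (k := k) (A := A) A (outer (k := k) (A := A) A A)) := by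
  let b := Module.finBasis k A
  refine .summand_of_eq (fun _ => AlgBimod.outer A A) (fun _ => .free)
    (fun m => outerLift (U := AlgBimod.outer A A) (contract (b.coord m)) fun c z =>
      DFunLike.congr_fun (outer_addHom_ext
        (f := (contract (b.coord m)).comp
          (DistribSMul.toAddMonoidHom (AlgBimod.outer (k := k) (A := A) A A) c))
        (g := (DistribSMul.toAddMonoidHom (AlgBimod.outer (k := k) (A := A) A A) c).comp
          (contract (b.coord m))) fun p q => by
        change ((1 : A) ⊗ₜ[k] (b.coord m p • (c • q)) : A ⊗[k] A) =
          (1 : A) ⊗ₜ[k] (c • (b.coord m p • q))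
        rw [smul_comm]) z)
    (fun m => outerLift (V := AlgBimod.regular k A) (U := AlgBimod.outer A (AlgBimod.outer A A))
      ((outerMk (AlgBimod.outer A A) 1).comp (outerMk (AlgBimod.regular k A) (b m)))
      fun _ _ => rfl) ?_
  refine outer_outer_addHom_ext (k := k) (P := A) (Q := A) (R := A) fun a c d => ?_
  refine (LinearMap.sum_apply _ _ (a ⊗ₜ[k] (c ⊗ₜ[k] d) : A ⊗[k] (A ⊗[k] A))).trans ?_
  change ∑ m, ((a * 1 * 1) ⊗ₜ[k] (b m ⊗ₜ[k] (b.coord m c • d)) : A ⊗[k] (A ⊗[k] A)) =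
    a ⊗ₜ[k] (c ⊗ₜ[k] d)
  simp only [mul_one, ← TensorProduct.tmul_sum, ← TensorProduct.smul_tmul,
    ← TensorProduct.sum_tmul, Module.Basis.coord_apply, Module.Basis.sum_repr]

lemma AddClosure.outer [Module.Finite k A] {V : AlgBimod k A} (hV : AddClosure V) :
    AddClosure (outer (k := k) (A := A) A V) := by
  induction hV with
  | regular => exact .free
  | free => exact .free_free
  | @summand W m Y hY i p h ih =>
    refine .summand_of_eq _ ih (fun x => outerMap (i x)) (fun x => outerMap (p x)) ?_
    refine outer_addHom_ext (k := k) (P := A) (Q := W) fun a v => ?_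
    refine (LinearMap.sum_apply _ _ (a ⊗ₜ[k] v : A ⊗[k] W)).trans ?_
    refine (Finset.sum_congr rfl fun x _ => (congrArg _ (outerMap_tmul (i x) a v)).trans
      (outerMap_tmul (p x) a _)).trans ?_
    exact (TensorProduct.tmul_sum a _ _).symm.trans (congrArg (a ⊗ₜ[k] ·) (h v))

/-- The map `v ↦ (a ⊗ b ↦ a ⊗ bv)`. -/
noncomputable def freeTensorAux (V : AlgBimod k A) :
    V →+ outer (k := k) (A := A) A A →+ outer (k := k) (A := A) A V :=
  AddMonoidHom.mk' (fun v => (LinearMap.lTensor A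
      ((LinearMap.toSpanSingleton A V v).restrictScalars k)).toAddMonoidHom)
    (fun v w => outer_addHom_ext fun a b => by
      change a ⊗ₜ[k] (b • (v + w)) = a ⊗ₜ[k] (b • v) + a ⊗ₜ[k] (b • w)
      rw [smul_add, TensorProduct.tmul_add])

/-- `(A ⊗ A) ⊗_A V → A ⊗ V`, `(a ⊗ b) ⊗ v ↦ a ⊗ bv`. -/
noncomputable def freeTensorHom (V : AlgBimod k A) :
    Tensor (outer (k := k) (A := A) A A) V →ₗ[A] outer (k := k) (A := A) A V :=
  tlift (freeTensorAux V).flip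
    (fun a z v => DFunLike.congr_fun (outer_addHom_ext
      (f := (freeTensorAux V v).comp
        (DistribSMul.toAddMonoidHom (outer (k := k) (A := A) A A) (MulOpposite.op a)))
      (g := freeTensorAux V (a • v)) fun p q => by
        change p ⊗ₜ[k] ((q * a) • v) = p ⊗ₜ[k] (q • a • v)
        rw [mul_smul]) z)
    (fun a z v => DFunLike.congr_fun (outer_addHom_ext
      (f := (freeTensorAux V v).comp
        (DistribSMul.toAddMonoidHom (outer (k := k) (A := A) A A) a))
      (g := (DistribSMul.toAddMonoidHom (outer (k := k) (A := A) A V) a).comp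
        (freeTensorAux V v)) fun _ _ => rfl) z)

/-- A left-linear map out of `W ⊗_A V` is a map of bimodules if it is so on pure tensors. -/
def tensorHom {W V U : AlgBimod k A} (f : Tensor W V →ₗ[A] U)
    (h : ∀ (b : Aᵐᵒᵖ) w v, f (tmk W w (b • v)) = b • f (tmk W w v)) : Hom (tensor W V) U where
  __ := f
  map_rsmul b z := DFunLike.congr_fun (tensor_addHom_ext
    (f := f.toAddMonoidHom.comp (DistribSMul.toAddMonoidHom (tensor W V) b))
    (g := (DistribSMul.toAddMonoidHom U b).comp f.toAddMonoidHom) fun w v => h b w v) z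

lemma AddClosure.tensor [Module.Finite k A] {W V : AlgBimod k A} (hW : AddClosure W)
    (hV : AddClosure V) : AddClosure (tensor W V) := by
  induction hW with
  | regular =>
    refine hV.of_retract (tensorHom (regularEquiv k V).toLinearMap
        fun b (a : A) v => (smul_comm a b v))
      { (regularEquiv k V).symm.toLinearMap with map_rsmul := fun _ _ => rfl }
      fun z => (regularEquiv k V).symm_apply_apply z
  | free =>
    refine hV.outer.of_retract (tensorHom (freeTensorHom V) ?_)
      (outerLift (U := AlgBimod.tensor (AlgBimod.outer A A) V)
        (tmkHom (AlgBimod.outer A A) ((1 : A) ⊗ₜ[k] (1 : A) : A ⊗[k] A)) fun _ _ => rfl) ?_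
    · intro b z v
      exact DFunLike.congr_fun (outer_addHom_ext
        (f := freeTensorAux V (b • v))
        (g := (DistribSMul.toAddMonoidHom (AlgBimod.outer (k := k) (A := A) A V) b).comp
          (freeTensorAux V v)) fun p q => congrArg (p ⊗ₜ[k] ·) (smul_comm q b v)) z
    · refine DFunLike.congr_fun (freeTensor_addHom_ext (V := V)
        (f := ((outerLift (U := AlgBimod.tensor (AlgBimod.outer A A) V) _
          fun _ _ => rfl).toLinearMap ∘ₗ freeTensorHom V).toAddMonoidHom)
        (g := AddMonoidHom.id _) fun a b v => ?_)
      refine (congrArg (a • ·) (tmk_rsmul (W := AlgBimod.outer A A) b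
        ((1 : A) ⊗ₜ[k] (1 : A) : A ⊗[k] A) v).symm).trans ?_
      refine congrArg (fun z : A ⊗[k] A => tmk (AlgBimod.outer A A) z v) ?_
      change (a * 1) ⊗ₜ[k] (1 * b) = a ⊗ₜ[k] b
      rw [mul_one, one_mul]
  | @summand W m Y hY i p h ih =>
    refine .summand_of_eq _ ih
      (fun x => tensorHom (U := AlgBimod.tensor (Y x) V) (tmap (i x) LinearMap.id)
        fun _ _ _ => rfl)
      (fun x => tensorHom (U := AlgBimod.tensor W V) (tmap (p x) LinearMap.id)
        fun _ _ _ => rfl) ?_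
    refine tensor_addHom_ext (W := W) (X := V) fun w v => ?_
    refine (LinearMap.sum_apply _ _ (tmk W w v)).trans ?_
    exact (map_sum ((tmkHom W).flip v) _ _).symm.trans (congrArg (tmk W · v) (h w))

end Closure
end AlgBimod

namespace ProjectiveFunctors

/-! ### The algebra `A` -/

section Algebra

variable (A : Type u) [Ring A]

/-- An idempotent is primitive if it is nonzero and not a sum of two nonzero orthogonal
idempotents. -/
def IsPrimitiveIdempotent {A : Type u} [Ring A] (e : A) : Prop :=
  IsIdempotentElem e ∧ e ≠ 0 ∧ ∀ f g : A, IsIdempotentElem f → IsIdempotentElem g →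
    f * g = 0 → g * f = 0 → e = f + g → f = 0 ∨ g = 0

/-- A decomposition of `1` as a sum of pairwise orthogonal primitive idempotents. -/
structure IsPrimitiveDecomposition {A : Type u} [Ring A] {n : ℕ} (e : Fin n → A) : Prop where
  complete : CompleteOrthogonalIdempotents e
  primitive : ∀ i, IsPrimitiveIdempotent (e i)

/-- The ring `A` is connected: it is nonzero and not a product of two nonzero rings. -/
def IsConnectedRing : Prop :=
  Nontrivial A ∧ ∀ z : A, IsIdempotentElem z → (∀ a, z * a = a * z) → z = 0 ∨ z = 1

variable {A}

/-- The left module `Ae`. -/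
abbrev leftProj (e : A) : Submodule A A := Submodule.span A {e}

/-- The right module `eA`. -/
abbrev rightProj (e : A) : Submodule Aᵐᵒᵖ A := Submodule.span Aᵐᵒᵖ {e}

variable (A)

/-- The algebra `A` is basic: the indecomposable projectives `Ae` appearing in a decomposition of
the regular module are pairwise non-isomorphic. -/
def IsBasic : Prop :=
  ∀ (n : ℕ) (e : Fin n → A), IsPrimitiveDecomposition e →
    ∀ i j, i ≠ j → IsEmpty (leftProj (e i) ≃ₗ[A] leftProj (e j))

variable {A}

/-- The left modules `Ae` and `Hom_k(fA, k)` are isomorphic, where `A` acts on the latter by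
`(a • φ) x = φ (x * a)`. -/
def ProjIsoInj (k : Type uk) [Field k] [Algebra k A] (e f : A) : Prop :=
  ∃ Φ : leftProj e ≃ₗ[k] (rightProj f →ₗ[k] k),
    ∀ (a : A) (x : leftProj e) (y : rightProj f), Φ (a • x) y = Φ x (MulOpposite.op a • y)

end Algebra

/-! ### The 2-category of projective functors -/

section TwoCategory

variable (k : Type uk) {A : Type u} [Field k] [Ring A] [Algebra k A]
  {C : Type uC} [Category.{vC} C] (E : C ≌ FGModuleCat.{u} A)

variable {k} in
/-- The endofunctor `G` of `C ≃ A-mod` is isomorphic to `W ⊗_A _`. -/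
def IsTensoringWith (G : C ⥤ C) (W : AlgBimod k A) : Prop :=
  Nonempty (G ⋙ E.functor ⋙ (ModuleCat.isFG A).ι ≅
    (E.functor ⋙ (ModuleCat.isFG A).ι) ⋙ W.tensorFunctor)

/-- The endofunctors of `C ≃ A-mod` isomorphic to tensoring with a bimodule from the additive
closure of `A` and `A ⊗ A`. -/
def isOneMorphism : ObjectProperty (C ⥤ C) := fun G =>
  ∃ W : AlgBimod k A, W.AddClosure ∧ IsTensoringWith E G W

lemma isOneMorphism_id : isOneMorphism k E (𝟭 C) :=
  ⟨.regular k A, .regular, ⟨Functor.leftUnitor _ ≪≫ (Functor.rightUnitor _).symm ≪≫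
    Functor.isoWhiskerLeft _ AlgBimod.regularIso.symm⟩⟩

variable {k E} in
lemma isOneMorphism_comp [Module.Finite k A] {G H : C ⥤ C} (hG : isOneMorphism k E G)
    (hH : isOneMorphism k E H) : isOneMorphism k E (G ⋙ H) := by
  obtain ⟨W, hW, ⟨α⟩⟩ := hG
  obtain ⟨V, hV, ⟨β⟩⟩ := hH
  exact ⟨V.tensor W, hV.tensor hW, ⟨Functor.associator _ _ _ ≪≫ Functor.isoWhiskerLeft G β ≪≫
    (Functor.associator _ _ _).symm ≪≫ Functor.isoWhiskerRight α V.tensorFunctor ≪≫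
    Functor.associator _ _ _ ≪≫ Functor.isoWhiskerLeft _ (AlgBimod.assocIso V W)⟩⟩

/-- The 2-category of projective functors of `A`, with its single object `pt`. -/
@[nolint unusedArguments]
inductive CA (k : Type uk) {A : Type u} [Field k] [Ring A] [Algebra k A]
    {C : Type uC} [Category.{vC} C] (E : C ≌ FGModuleCat.{u} A) : Type
  | pt

/-- The category of 1-morphisms and 2-morphisms: endofunctors of `C` as above and all natural
transformations. -/
abbrev OneMorphism := (isOneMorphism k E).FullSubcategory

variable {k E} in
lemma oneMorphism_hom_ext {G H : OneMorphism k E} {η θ : G ⟶ H}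
    (h : ∀ X, η.hom.app X = θ.hom.app X) : η = θ :=
  ObjectProperty.hom_ext _ (NatTrans.ext (funext h))

variable [Module.Finite k A]

instance : CategoryStruct (CA k E) where
  Hom _ _ := OneMorphism k E
  id _ := ⟨𝟭 C, isOneMorphism_id k E⟩
  comp G H := ⟨G.obj ⋙ H.obj, isOneMorphism_comp G.property H.property⟩

/-- Whiskering and composition are those of functors. -/
instance : Bicategory (CA k E) where
  homCategory _ _ := inferInstanceAs (Category (OneMorphism k E))
  whiskerLeft G _ _ η := ⟨Functor.whiskerLeft G.obj η.hom⟩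
  whiskerRight η H := ⟨Functor.whiskerRight η.hom H.obj⟩
  associator F G H := (isOneMorphism k E).isoMk (Functor.associator F.obj G.obj H.obj)
  leftUnitor F := (isOneMorphism k E).isoMk (Functor.leftUnitor F.obj)
  rightUnitor F := (isOneMorphism k E).isoMk (Functor.rightUnitor F.obj)
  whiskerLeft_id _ _ := oneMorphism_hom_ext fun _ => rfl
  whiskerLeft_comp _ _ _ _ _ _ := oneMorphism_hom_ext fun _ => rfl
  id_whiskerLeft η := oneMorphism_hom_ext fun X =>
    ((Category.id_comp _).trans (Category.comp_id (η.hom.app X))).symm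
  comp_whiskerLeft F G _ _ η := oneMorphism_hom_ext fun X =>
    ((Category.id_comp _).trans (Category.comp_id (η.hom.app (G.obj.obj (F.obj.obj X))))).symm
  id_whiskerRight _ G := oneMorphism_hom_ext fun _ => G.obj.map_id _
  comp_whiskerRight _ _ G := oneMorphism_hom_ext fun _ => G.obj.map_comp _ _
  whiskerRight_id η := oneMorphism_hom_ext fun X =>
    ((Category.id_comp _).trans (Category.comp_id (η.hom.app X))).symm
  whiskerRight_comp η G H := oneMorphism_hom_ext fun X =>
    ((Category.id_comp _).trans
      (Category.comp_id (H.obj.map (G.obj.map (η.hom.app X))))).symm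
  whisker_assoc F _ _ η H := oneMorphism_hom_ext fun X =>
    ((Category.id_comp _).trans
      (Category.comp_id (H.obj.map (η.hom.app (F.obj.obj X))))).symm
  whisker_exchange η θ := oneMorphism_hom_ext fun X =>
    (θ.hom.naturality (η.hom.app X)).symm
  pentagon F G H I := oneMorphism_hom_ext fun X => by
    change I.obj.map (𝟙 _) ≫ 𝟙 _ ≫ 𝟙 _ = 𝟙 _ ≫ 𝟙 _
    rw [I.obj.map_id]
    exact Category.id_comp _
  triangle F G := oneMorphism_hom_ext fun X => by
    change 𝟙 _ ≫ 𝟙 _ = G.obj.map (𝟙 _)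
    rw [G.obj.map_id]
    exact Category.id_comp _

/-- It is a (strict) 2-category. -/
instance : Bicategory.Strict (CA k E) where
  id_comp _ := rfl
  comp_id _ := rfl
  assoc _ _ _ := rfl
  leftUnitor_eqToIso _ := rfl
  rightUnitor_eqToIso _ := rfl
  associator_eqToIso _ _ _ := rfl

section Linear

variable [Preadditive C] [Linear k C]

instance (a b : CA k E) : Preadditive (a ⟶ b) :=
  inferInstanceAs (Preadditive (OneMorphism k E))

instance (a b : CA k E) : Linear k (a ⟶ b) :=
  inferInstanceAs (Linear k (OneMorphism k E))

end Linear

end TwoCategory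

/-! ### Finitary 2-representations -/

section TwoRepresentations

variable (k : Type uk) {A : Type u} [Field k] [Ring A] [Algebra k A] [Module.Finite k A]
  {C : Type uC} [Category.{vC} C] [Preadditive C] [Linear k C] (E : C ≌ FGModuleCat.{u} A)

attribute [local instance] hasBinaryBiproducts_of_finite_biproducts

/-- A finitary 2-representation: a strict 2-functor to categories whose value at the object is an
additive, idempotent split, Krull-Schmidt, `k`-linear category with finitely many isomorphism
classes of indecomposable objects and finite dimensional morphism spaces, such that 1-morphisms
act by additive `k`-linear functors and the action is `k`-linear on 2-morphisms. -/
structure FinitaryTwoRep where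
  act : StrictPseudofunctor (CA k E) Cat.{v, w}
  [preadditive : Preadditive (act.obj .pt)]
  [linear : Linear k (act.obj .pt)]
  [hasFiniteBiproducts : HasFiniteBiproducts (act.obj .pt)]
  [idempotentComplete : IsIdempotentComplete (act.obj .pt)]
  krullSchmidt : ∀ X : act.obj .pt, ∃ (n : ℕ) (Y : Fin n → act.obj .pt),
    (∀ i, IsLocalRing (End (Y i))) ∧ Nonempty (X ≅ ⨁ Y)
  finite_indecomposables : ∃ (n : ℕ) (Y : Fin n → act.obj .pt),
    ∀ X : act.obj .pt, Indecomposable X → ∃ i, Nonempty (X ≅ Y i)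
  finite_hom : ∀ X Y : act.obj .pt, Module.Finite k (X ⟶ Y)
  [map_additive : ∀ F : OneMorphism k E, (act.map (X := .pt) (Y := .pt) F).toFunctor.Additive]
  [map_linear : ∀ F : OneMorphism k E, (act.map (X := .pt) (Y := .pt) F).toFunctor.Linear k]
  map₂_add : ∀ {F G : (CA.pt : CA k E) ⟶ .pt} (η θ : F ⟶ G),
    (act.map₂ (η + θ)).toNatTrans = (act.map₂ η).toNatTrans + (act.map₂ θ).toNatTrans
  map₂_smul : ∀ {F G : (CA.pt : CA k E) ⟶ .pt} (c : k) (η : F ⟶ G),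
    (act.map₂ (c • η)).toNatTrans = c • (act.map₂ η).toNatTrans

namespace FinitaryTwoRep

variable {k E} (M : FinitaryTwoRep.{uk, u, vC, uC, v, w} k E)

/-- The category on which the 2-representation acts. -/
abbrev category : Type w := M.act.obj .pt

attribute [instance] preadditive linear hasFiniteBiproducts idempotentComplete

/-- The functor by which a 1-morphism acts. -/
abbrev functor (F : OneMorphism k E) : M.category ⥤ M.category :=
  (M.act.map (X := .pt) (Y := .pt) F).toFunctor

instance (F : OneMorphism k E) : (M.functor F).Additive := M.map_additive F

instance (F : OneMorphism k E) : (M.functor F).Linear k := M.map_linear F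

/-- Transitivity: for all indecomposable `X` and `Y`, some 1-morphism `F` has `Y` as a direct
summand of `F X` (in an idempotent split category, direct summands are retracts). -/
def IsTransitive : Prop :=
  ∀ X Y : M.category, Indecomposable X → Indecomposable Y →
    ∃ F : OneMorphism k E, Nonempty (Retract Y ((M.functor F).obj X))

/-- A two-sided ideal of morphisms that is invariant under the action. -/
structure InvariantIdeal where
  carrier : ∀ X Y : M.category, Submodule k (X ⟶ Y)
  comp_mem : ∀ {X Y Z : M.category} (f : X ⟶ Y) (g : Y ⟶ Z), f ∈ carrier X Y →
    f ≫ g ∈ carrier X Z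
  mem_comp : ∀ {X Y Z : M.category} (f : X ⟶ Y) (g : Y ⟶ Z), g ∈ carrier Y Z →
    f ≫ g ∈ carrier X Z
  map_mem : ∀ (F : OneMorphism k E) {X Y : M.category} (f : X ⟶ Y), f ∈ carrier X Y →
    (M.functor F).map f ∈ carrier _ _

/-- A simple transitive 2-representation: it is transitive, and the only invariant ideals are zero
and everything. -/
structure IsSimpleTransitive : Prop where
  transitive : M.IsTransitive
  simple : ∀ I : M.InvariantIdeal,
    (∀ X Y, I.carrier X Y = ⊥) ∨ (∀ X Y, I.carrier X Y = ⊤)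

end FinitaryTwoRep

end TwoRepresentations

/-! ### Abelianization -/

section Abelianization

variable {V : Type*} [Category* V] [Preadditive V] {V' : Type*} [Category* V'] [Preadditive V']

/-- The functor induced by an additive functor on categories of diagrams `X ⟶ Y` modulo
homotopy. -/
def mapFreyd (G : V ⥤ V') [G.Additive] :
    Preadditive.RightFreyd V ⥤ Preadditive.RightFreyd V' :=
  CategoryTheory.Quotient.lift _ (G.mapArrow ⋙ Preadditive.RightFreyd.quotient V')
    (fun _ _ f g ⟨h⟩ => Preadditive.RightFreyd.eq_of_rightHomotopy _ _
      { hom := G.map h.hom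
        comm := by
          have := congrArg G.map h.comm
          rw [Functor.map_sub, Functor.map_comp] at this
          exact this })

variable {k : Type uk} {A : Type u} [Field k] [Ring A] [Algebra k A] [Module.Finite k A]
  {C : Type uC} [Category.{vC} C] [Preadditive C] [Linear k C] {E : C ≌ FGModuleCat.{u} A}

namespace FinitaryTwoRep

/-- The abelianization of the underlying category: objects are diagrams `η : X ⟶ Y`; morphisms
from `η` to `η'` are commutative squares, modulo those squares whose component `Y ⟶ Y'` factors
through `η'`. -/
abbrev Abelianization (M : FinitaryTwoRep.{uk, u, vC, uC, v, w} k E) :=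
  Preadditive.RightFreyd M.category

/-- The (componentwise) action of a 1-morphism on the abelianization. -/
def abelianizedFunctor (M : FinitaryTwoRep.{uk, u, vC, uC, v, w} k E) (F : OneMorphism k E) :
    M.Abelianization ⥤ M.Abelianization :=
  mapFreyd (M.functor F)

end FinitaryTwoRep

end Abelianization

end ProjectiveFunctors

open ProjectiveFunctors

/-! Right exactness is formal: cokernels in the Freyd category are built from biproducts, so the
functor induced by any additive functor preserves them (`mapFreyd_preservesFiniteColimits`). The
content is the preservation of limits. Each Ae_i ⊗ e_jA is a retract of A ⊗ A, so F is a summand of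
a finite power of U, the 1-morphism of A ⊗ A. Preservation of limits passes to summands of powers,
hence it suffices to treat U.

Let R and S be the 1-morphisms of A ⊗ e_tA and Ae_s ⊗ A. Since Ae_s is the dual of e_tA, R is left
adjoint to S (`AlgBimod.tensorAdjunction`). A 2-functor preserves adjunctions, and so does passage
to Freyd categories; hence S acts on the abelianization as a right adjoint and preserves limits.
Moreover (Ae_s ⊗ A) ⊗_A (A ⊗ A) is a power of Ae_s ⊗ A, so "U, then S" preserves limits as well.

It remains to cancel S (`mapFreyd_preservesLimitsOfShape`). If c is a limit cone, then S(U(c)) is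
one, and by adjunction U(c) has the universal property of a limit for maps out of objects R(X). For
every 1-morphism G, "R, then G" is a summand of a power of R; with transitivity, every object of
M(i) is then a summand of a power of R(X) as soon as R(X) is non-zero
(`FinitaryTwoRep.isSummandOfPower_obj`). So U(c) passes the test on all objects coming from M(i),
and these present all objects of the Freyd category. A suitable X exists unless U acts by zero, a
trivial case: if U(Y) is non-zero, so is R(U(Y)), because (A ⊗ e_tA) ⊗_A (A ⊗ A) has A ⊗ A as a
direct summand. -/

/-! ### Direct summands of finite powers. -/

section SummandOfPower

variable {V : Type*} [Category* V] [Preadditive V] {V' : Type*} [Category* V'] [Preadditive V']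

/-- `Z` is a direct summand of a finite power of `T`, expressed without biproducts. -/
def IsSummandOfPower (Z T : V) : Prop :=
  ∃ (ι : Type) (_ : Fintype ι) (i : ι → (Z ⟶ T)) (p : ι → (T ⟶ Z)), ∑ a, i a ≫ p a = 𝟙 Z

namespace IsSummandOfPower

lemma of_retract {Z T : V} (i : Z ⟶ T) (p : T ⟶ Z) (h : i ≫ p = 𝟙 Z) : IsSummandOfPower Z T :=
  ⟨Unit, inferInstance, fun _ => i, fun _ => p, by simpa using h⟩

lemma of_iso {Z T : V} (e : Z ≅ T) : IsSummandOfPower Z T := of_retract e.hom e.inv e.hom_inv_id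

lemma of_isZero {Z : V} (T : V) (h : IsZero Z) : IsSummandOfPower Z T :=
  ⟨Empty, inferInstance, Empty.elim, Empty.elim, h.eq_of_src _ _⟩

lemma of_family {ι : Type} [Fintype ι] {Z T : V} (Y : ι → V) (i : ∀ a, Z ⟶ Y a) (p : ∀ a, Y a ⟶ Z)
    (h : ∑ a, i a ≫ p a = 𝟙 Z) (hY : ∀ a, IsSummandOfPower (Y a) T) : IsSummandOfPower Z T := by
  choose κ hκ j q hjq using hY
  refine ⟨Σ a, κ a, inferInstance, fun x => i x.1 ≫ j x.1 x.2, fun x => q x.1 x.2 ≫ p x.1, ?_⟩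
  rw [← h, Fintype.sum_sigma]
  refine Finset.sum_congr rfl fun a _ => ?_
  calc ∑ b, (i a ≫ j a b) ≫ q a b ≫ p a = i a ≫ (∑ b, j a b ≫ q a b) ≫ p a := by
        simp [Preadditive.comp_sum, Preadditive.sum_comp]
    _ = i a ≫ p a := by rw [hjq, Category.id_comp]

lemma trans {Z Y T : V} (h : IsSummandOfPower Z Y) (h' : IsSummandOfPower Y T) :
    IsSummandOfPower Z T := by
  obtain ⟨ι, _, i, p, hip⟩ := h
  exact of_family (fun _ => Y) i p hip fun _ => h'

lemma map {Z T : V} (h : IsSummandOfPower Z T) (G : V ⥤ V') [G.Additive] :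
    IsSummandOfPower (G.obj Z) (G.obj T) := by
  obtain ⟨ι, _, i, p, hip⟩ := h
  refine ⟨ι, inferInstance, fun a => G.map (i a), fun a => G.map (p a), ?_⟩
  simp only [← G.map_comp, ← G.map_sum, hip, G.map_id]

lemma app {V : Type*} [Category* V] {F H : V ⥤ V'} (h : IsSummandOfPower F H) (X : V) :
    IsSummandOfPower (F.obj X) (H.obj X) :=
  h.map ((evaluation V V').obj X)

lemma isZero {Z T : V} (h : IsSummandOfPower Z T) (hT : IsZero T) : IsZero Z := by
  obtain ⟨ι, _, i, p, hip⟩ := h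
  rw [IsZero.iff_id_eq_zero, ← hip]
  exact Finset.sum_eq_zero fun a _ => by rw [hT.eq_of_tgt (i a) 0, zero_comp]

/-- A cone over the F-diagram is pushed along each `i a` to the H-diagram, lifted there, and brought
back along `p a`; the sum of the results is the lift. It is unique because `m` is recovered from the
composites of `m` with the `i a`, which are lifts for H. -/
lemma preservesLimitsOfShape {J V : Type*} [Category* J] [Category* V] {F H : V ⥤ V'}
    (h : IsSummandOfPower F H) [PreservesLimitsOfShape J H] : PreservesLimitsOfShape J F where
  preservesLimit {K} := ⟨fun {c} hc => by
    obtain ⟨ι, _, i, p, hip⟩ := h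
    have hip' (X : V) : ∑ a, (i a).app X ≫ (p a).app X = 𝟙 (F.obj X) := by
      simpa using congrArg (fun t => t.app X) hip
    have hH := isLimitOfPreserves H hc
    let t (s : Cone (K ⋙ F)) (a : ι) : Cone (K ⋙ H) :=
      (Cone.postcompose (Functor.whiskerLeft K (i a))).obj s
    refine ⟨⟨fun s => ∑ a, hH.lift (t s a) ≫ (p a).app c.pt, fun s j => ?_, fun s m hm => ?_⟩⟩
    · have h1 (a : ι) : hH.lift (t s a) ≫ H.map (c.π.app j) =
          s.π.app j ≫ (i a).app (K.obj j) := hH.fac (t s a) j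
      have h2 (a : ι) : hH.lift (t s a) ≫ (p a).app c.pt ≫ F.map (c.π.app j) =
          s.π.app j ≫ (i a).app (K.obj j) ≫ (p a).app (K.obj j) := by
        rw [← (p a).naturality, reassoc_of% (h1 a)]
      change (∑ a, _) ≫ F.map (c.π.app j) = _
      simp only [Preadditive.sum_comp, Category.assoc, h2, ← Preadditive.comp_sum, hip']
      exact Category.comp_id _
    · have h3 (a : ι) : m ≫ (i a).app c.pt = hH.lift (t s a) := by
        refine hH.hom_ext fun j => ?_
        rw [hH.fac]
        change (m ≫ (i a).app c.pt) ≫ H.map (c.π.app j) = s.π.app j ≫ (i a).app (K.obj j)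
        rw [Category.assoc, ← (i a).naturality, ← hm j, Category.assoc]
        rfl
      simp only [← h3, Category.assoc, ← Preadditive.comp_sum]
      rw [hip']
      exact (Category.comp_id m).symm⟩

end IsSummandOfPower

lemma IsSummandOfPower.of_isBilimit {ι : Type} [Fintype ι] {f : ι → V}
    {b : Bicone f} (hb : b.IsBilimit) {T : V} (h : ∀ a, IsSummandOfPower (f a) T) :
    IsSummandOfPower b.pt T :=
  .of_family f b.π b.ι (IsBilimit.total hb) h

end SummandOfPower

/-! ### Limit cones tested one object at a time. -/

section TestObjects

variable {J : Type*} [Category* J] {V : Type*} [Category* V] {K : J ⥤ V}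

/-- The cone `c` has the universal property of a limit with respect to maps out of `Z`. -/
def IsLimitAt (c : Cone K) (Z : V) : Prop :=
  ∀ π : (Functor.const J).obj Z ⟶ K, ∃! l : Z ⟶ c.pt, ∀ j, l ≫ c.π.app j = π.app j

namespace IsLimitAt

variable {c : Cone K}

lemma nonempty_isLimit (h : ∀ Z, IsLimitAt c Z) : Nonempty (IsLimit c) := by
  choose l hl using fun s : Cone K => h s.pt s.π
  exact ⟨⟨l, fun s => (hl s).1, fun s m hm => (hl s).2 m hm⟩⟩

lemma hom_ext {Z : V} (h : IsLimitAt c Z) {f g : Z ⟶ c.pt}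
    (hfg : ∀ j, f ≫ c.π.app j = g ≫ c.π.app j) : f = g := by
  obtain ⟨l, -, hl⟩ := h ((Functor.const J).map g ≫ c.π)
  rw [hl f hfg, hl g fun j => rfl]

/-- A cone with vertex `Z` restricts along each `p a` to one with vertex `T`; the lifts obtained
there are reassembled with the `i a`. -/
lemma of_isSummandOfPower [Preadditive V] {Z T : V} (hT : IsLimitAt c T)
    (h : IsSummandOfPower Z T) : IsLimitAt c Z := by
  obtain ⟨ι, _, i, p, hip⟩ := h
  intro π
  choose l hl using fun a => (hT ((Functor.const J).map (p a) ≫ π)).exists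
  refine ⟨∑ a, i a ≫ l a, fun j => ?_, fun m hm => ?_⟩
  · have h1 (a : ι) : i a ≫ l a ≫ c.π.app j = (i a ≫ p a) ≫ π.app j := by
      rw [hl, Category.assoc]; rfl
    simp only [Preadditive.sum_comp, Category.assoc]
    simp only [h1, ← Preadditive.sum_comp]
    rw [hip]
    exact Category.id_comp _
  · have h2 (a : ι) : p a ≫ m = l a := hT.hom_ext fun j => by
      rw [hl, Category.assoc, hm]; rfl
    simp only [← h2, ← Category.assoc, ← Preadditive.sum_comp, hip, Category.id_comp]

/-- The lift exists on `Y`, and uniqueness at `X` shows that it kills `f`, so it descends to the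
cokernel `Z`. This reduces the test on all objects to the test on the objects that present them. -/
lemma of_cokernel [HasZeroMorphisms V] {Z X Y : V} {f : X ⟶ Y} (hX : IsLimitAt c X)
    (hY : IsLimitAt c Y) (p : Y ⟶ Z) [Epi p] (w : f ≫ p = 0)
    (hp : ∀ {T : V} (g : Y ⟶ T), f ≫ g = 0 → ∃ d : Z ⟶ T, p ≫ d = g) : IsLimitAt c Z := by
  intro π
  obtain ⟨l, hl, -⟩ := hY ((Functor.const J).map p ≫ π)
  have h0 : f ≫ l = 0 := hX.hom_ext fun j => by
    rw [Category.assoc, hl, zero_comp]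
    change f ≫ p ≫ π.app j = 0
    rw [reassoc_of% w, zero_comp]
  obtain ⟨d, rfl⟩ := hp l h0
  refine ⟨d, fun j => ?_, fun m hm => ?_⟩
  · rw [← cancel_epi p, ← Category.assoc, hl]
    rfl
  · rw [← cancel_epi p]
    refine hY.hom_ext fun j => ?_
    rw [hl, Category.assoc, hm]
    rfl

/-- Transposition turns factorizations through `c` of a cone on `L.obj X` into factorizations
through the limit cone `R.mapCone c` of a cone on `X`. Nothing is assumed about `c` itself, so this
extracts what remains of the limit property once `R` is removed. -/
lemma of_adjunction {V' : Type*} [Category* V'] {L : V' ⥤ V} {R : V ⥤ V'} (adj : L ⊣ R)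
    (h : IsLimit (R.mapCone c)) (X : V') : IsLimitAt c (L.obj X) := by
  intro π
  let s : Cone (K ⋙ R) :=
    { pt := X
      π := { app j := adj.homEquiv _ _ (π.app j)
             naturality i j f := by
              have := π.naturality f
              dsimp at this ⊢
              rw [Category.id_comp] at this ⊢
              rw [this, adj.homEquiv_naturality_right] } }
  have key (l : L.obj X ⟶ c.pt) : (∀ j, l ≫ c.π.app j = π.app j) ↔
      ∀ j, adj.homEquiv _ _ l ≫ (R.mapCone c).π.app j = s.π.app j := by
    refine forall_congr' fun j => ?_
    rw [← (adj.homEquiv _ _).apply_eq_iff_eq, adj.homEquiv_naturality_right]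
    rfl
  refine ⟨(adj.homEquiv _ _).symm (h.lift s), (key _).2 fun j => ?_, fun m hm => ?_⟩
  · rw [Equiv.apply_symm_apply, h.fac]
  · rw [Equiv.eq_symm_apply]
    exact h.uniq s _ ((key m).1 hm)

end IsLimitAt

end TestObjects

/-! ### Freyd categories and the functors induced on them. -/

section Freyd

open Preadditive

variable {V : Type*} [Category* V] [Preadditive V] {V' : Type*} [Category* V'] [Preadditive V']
  {V'' : Type*} [Category* V''] [Preadditive V'']

namespace CategoryTheory.Preadditive.RightFreyd

lemma exists_quotient_obj_eq (X : RightFreyd V) : ∃ u, (RightFreyd.quotient V).obj u = X :=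
  ⟨X.as, rfl⟩

lemma quotient_map_comp_eq {u v v' w : Arrow V} {f : u ⟶ v} {g : v ⟶ w} {f' : u ⟶ v'}
    {g' : v' ⟶ w} (h : f ≫ g = f' ≫ g') :
    (RightFreyd.quotient V).map f ≫ (RightFreyd.quotient V).map g =
      (RightFreyd.quotient V).map f' ≫ (RightFreyd.quotient V).map g' := by
  rw [← Functor.map_comp, ← Functor.map_comp, h]

/-- The object `X` of `V` as the object `0 : X ⟶ X` of the Freyd category. -/
def proj (V : Type*) [Category* V] [Preadditive V] : V ⥤ RightFreyd V where
  obj X := (RightFreyd.quotient V).obj (Arrow.mk (0 : X ⟶ X))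
  map f := (RightFreyd.quotient V).map (Arrow.homMk f f (by simp))
  map_id X := (RightFreyd.quotient V).map_id _
  map_comp f g := by rw [← Functor.map_comp]; rfl

instance : (proj V).Additive where
  map_add {X Y f g} := (RightFreyd.quotient V).map_add
    (f := Arrow.homMk (f := Arrow.mk (0 : X ⟶ X)) (g := Arrow.mk (0 : Y ⟶ Y)) f f (by simp))
    (g := Arrow.homMk g g (by simp))

/-- The canonical epimorphism from (the image of) `Y` to the object `X ⟶ Y`. -/
def projπ (u : Arrow V) : (proj V).obj u.right ⟶ (RightFreyd.quotient V).obj u :=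
  (RightFreyd.quotient V).map (Arrow.homMk 0 (𝟙 _) (by simp))

instance (u : Arrow V) : Epi (projπ u) := by
  have : IsIso (Arrow.homMk (f := Arrow.mk (0 : u.right ⟶ u.right)) (g := u) 0 (𝟙 _)
    (by simp)).right := inferInstanceAs (IsIso (𝟙 u.right))
  exact RightFreyd.epi_of_isIso_right _

lemma map_comp_projπ (u : Arrow V) : (proj V).map u.hom ≫ projπ u = 0 := by
  refine ((RightFreyd.quotient V).map_comp _ _).symm.trans ?_
  exact (RightFreyd.quotient_map_eq_zero_iff _).2
    -- The codomain component of the composite square is `u.hom`, which factors through `u.hom` by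
    -- the identity.
    ⟨{ hom := 𝟙 _, comm := by simp }⟩

/-- With the two preceding facts this makes `projπ u` a cokernel of the image of `u.hom`. A
null-homotopy of the composite supplies exactly the missing domain component of the descended
square. -/
lemma exists_projπ_comp_eq (u : Arrow V) {T : RightFreyd V} (g : (proj V).obj u.right ⟶ T)
    (hg : (proj V).map u.hom ≫ g = 0) : ∃ d, projπ u ≫ d = g := by
  obtain ⟨w, rfl⟩ := RightFreyd.exists_quotient_obj_eq T
  obtain ⟨g, rfl⟩ := (RightFreyd.quotient V).map_surjective g
  obtain ⟨⟨h, hh⟩⟩ := (RightFreyd.quotient_map_eq_zero_iff _).1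
    (((RightFreyd.quotient V).map_comp _ _).trans hg)
  refine ⟨(RightFreyd.quotient V).map (Arrow.homMk h g.right ?_), ?_⟩
  · simpa using hh.symm
  · refine ((RightFreyd.quotient V).map_comp _ _).symm.trans ?_
    -- Homotopy sees only the codomain components, and these agree, so the zero homotopy works.
    exact (RightFreyd.quotient_map_eq_iff _ _).2 ⟨{ hom := 0, comm := by simp }⟩

/-- The object given by an arrow `u` is the cokernel of the image of `u.hom` between two objects
coming from `V`. -/
lemma isLimitAt_of_proj {J : Type*} [Category* J] {K : J ⥤ RightFreyd V} {c : Cone K}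
    (h : ∀ X : V, IsLimitAt c ((proj V).obj X)) (Z : RightFreyd V) : IsLimitAt c Z := by
  obtain ⟨u, rfl⟩ := RightFreyd.exists_quotient_obj_eq Z
  exact (h u.left).of_cokernel (h u.right) (projπ u) (map_comp_projπ u)
    (exists_projπ_comp_eq u)

section

variable [HasBinaryBiproducts V]

instance : HasBinaryBiproducts (RightFreyd V) where
  has_binary_biproduct X Y := by
    obtain ⟨u, rfl⟩ := RightFreyd.exists_quotient_obj_eq X
    obtain ⟨v, rfl⟩ := RightFreyd.exists_quotient_obj_eq Y
    let Q := RightFreyd.quotient V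
    let b : BinaryBicone (Q.obj u) (Q.obj v) :=
      { pt := Q.obj (Arrow.mk (biprod.map u.hom v.hom))
        fst := Q.map (Arrow.homMk biprod.fst biprod.fst (by simp))
        snd := Q.map (Arrow.homMk biprod.snd biprod.snd (by simp))
        inl := Q.map (Arrow.homMk biprod.inl biprod.inl (by simp))
        inr := Q.map (Arrow.homMk biprod.inr biprod.inr (by simp))
        inl_fst := by
          rw [← Q.map_comp, ← Q.map_id]; congr 1; ext <;> simp
        inl_snd := by
          rw [← Q.map_comp, ← Q.map_zero]; congr 1; ext <;> simp
        inr_fst := by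
          rw [← Q.map_comp, ← Q.map_zero]; congr 1; ext <;> simp
        inr_snd := by
          rw [← Q.map_comp, ← Q.map_id]; congr 1; ext <;> simp }
    refine hasBinaryBiproduct_of_total b ?_
    change Q.map _ ≫ Q.map _ + Q.map _ ≫ Q.map _ = 𝟙 (Q.obj _)
    rw [← Q.map_comp, ← Q.map_comp, ← Q.map_add, ← Q.map_id]
    congr 1
    ext
    · exact biprod.total
    · exact biprod.total

open ZeroObject in
instance [HasZeroObject V] : HasZeroObject (RightFreyd V) :=
  ⟨(proj V).obj 0, (IsZero.iff_id_eq_zero _).2 (((proj V).map_id 0).symm.trans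
      ((congrArg _ ((isZero_zero V).eq_of_src (𝟙 _) 0)).trans ((proj V).map_zero _ _)))⟩

end

end CategoryTheory.Preadditive.RightFreyd

namespace ProjectiveFunctors

open RightFreyd

instance (G : V ⥤ V') [G.Additive] : (mapFreyd G).Additive where
  map_add {X Y f g} := by
    obtain ⟨u, rfl⟩ := RightFreyd.exists_quotient_obj_eq X
    obtain ⟨v, rfl⟩ := RightFreyd.exists_quotient_obj_eq Y
    obtain ⟨f, rfl⟩ := (RightFreyd.quotient V).map_surjective f
    obtain ⟨g, rfl⟩ := (RightFreyd.quotient V).map_surjective g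
    rw [← Functor.map_add]
    refine Eq.trans (congrArg (RightFreyd.quotient V').map ?_) (RightFreyd.quotient V').map_add
    ext
    · exact G.map_add
    · exact G.map_add

/-- The natural transformation of functors on Freyd categories induced by a natural
transformation. -/
def mapFreydHom {G H : V ⥤ V'} [G.Additive] [H.Additive] (α : G ⟶ H) :
    mapFreyd G ⟶ mapFreyd H :=
  Quotient.natTransLift _
    { app u := (RightFreyd.quotient V').map (Arrow.homMk (α.app u.left) (α.app u.right)
        (α.naturality u.hom).symm)
      naturality u v f := by
        refine quotient_map_comp_eq ?_
        ext
        · exact α.naturality f.left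
        · exact α.naturality f.right }

lemma freyd_natTrans_ext {W : Type*} [Category* W] {G H : RightFreyd V ⥤ W} {α β : G ⟶ H}
    (h : ∀ u : Arrow V, α.app ((RightFreyd.quotient V).obj u) =
      β.app ((RightFreyd.quotient V).obj u)) : α = β := by
  ext X
  obtain ⟨u, rfl⟩ := RightFreyd.exists_quotient_obj_eq X
  exact h u

lemma mapFreydHom_comp {G H I : V ⥤ V'} [G.Additive] [H.Additive] [I.Additive] (α : G ⟶ H)
    (β : H ⟶ I) : mapFreydHom (α ≫ β) = mapFreydHom α ≫ mapFreydHom β :=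
  freyd_natTrans_ext fun u => (RightFreyd.quotient V').map_comp
    (Arrow.homMk (f := G.mapArrow.obj u) (g := H.mapArrow.obj u) (α.app u.left) (α.app u.right)
      (α.naturality u.hom).symm)
    (Arrow.homMk (g := I.mapArrow.obj u) (β.app u.left) (β.app u.right)
      (β.naturality u.hom).symm)

lemma mapFreydHom_id (G : V ⥤ V') [G.Additive] : mapFreydHom (𝟙 G) = 𝟙 _ :=
  freyd_natTrans_ext fun _ => (RightFreyd.quotient V').map_id _

lemma mapFreydHom_sum {ι : Type} [Fintype ι] {G H : V ⥤ V'} [G.Additive] [H.Additive]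
    (α : ι → (G ⟶ H)) : mapFreydHom (∑ a, α a) = ∑ a, mapFreydHom (α a) := by
  let φ : (G ⟶ H) →+ (mapFreyd G ⟶ mapFreyd H) := AddMonoidHom.mk' mapFreydHom fun α β =>
    freyd_natTrans_ext fun u => (RightFreyd.quotient V').map_add
      (f := Arrow.homMk (f := G.mapArrow.obj u) (g := H.mapArrow.obj u) (α.app u.left)
        (α.app u.right) (α.naturality u.hom).symm)
      (g := Arrow.homMk (f := G.mapArrow.obj u) (g := H.mapArrow.obj u) (β.app u.left)
        (β.app u.right) (β.naturality u.hom).symm)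
  exact map_sum φ _ _

end ProjectiveFunctors

open ProjectiveFunctors

lemma IsSummandOfPower.mapFreyd {G H : V ⥤ V'} [G.Additive] [H.Additive]
    (h : IsSummandOfPower G H) : IsSummandOfPower (mapFreyd G) (mapFreyd H) := by
  obtain ⟨ι, _, i, p, hip⟩ := h
  refine ⟨ι, inferInstance, fun a => mapFreydHom (i a), fun a => mapFreydHom (p a), ?_⟩
  simp only [← mapFreydHom_comp, ← mapFreydHom_sum, hip, mapFreydHom_id]

namespace ProjectiveFunctors

/-- An adjunction induces an adjunction on Freyd categories. -/
def mapFreydAdjunction {L : V ⥤ V'} {R : V' ⥤ V} [L.Additive] [R.Additive] (adj : L ⊣ R) :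
    mapFreyd L ⊣ mapFreyd R where
  unit := Quotient.natTransLift _
    { app u := (RightFreyd.quotient V).map (Arrow.homMk (g := R.mapArrow.obj (L.mapArrow.obj u))
        (adj.unit.app u.left) (adj.unit.app u.right) (adj.unit.naturality u.hom).symm)
      naturality u v f := by
        refine RightFreyd.quotient_map_comp_eq ?_
        ext
        · exact adj.unit.naturality f.left
        · exact adj.unit.naturality f.right }
  counit := Quotient.natTransLift _
    { app u := (RightFreyd.quotient V').map (Arrow.homMk (f := L.mapArrow.obj (R.mapArrow.obj u))
        (adj.counit.app u.left) (adj.counit.app u.right) (adj.counit.naturality u.hom).symm)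
      naturality u v f := by
        refine RightFreyd.quotient_map_comp_eq ?_
        ext
        · exact adj.counit.naturality f.left
        · exact adj.counit.naturality f.right }
  left_triangle_components X := by
    obtain ⟨u, rfl⟩ := RightFreyd.exists_quotient_obj_eq X
    refine ((RightFreyd.quotient V').map_comp _ _).symm.trans ?_
    refine Eq.trans ?_ ((RightFreyd.quotient V').map_id _)
    congr 1
    ext
    · exact adj.left_triangle_components _
    · exact adj.left_triangle_components _
  right_triangle_components X := by
    obtain ⟨u, rfl⟩ := RightFreyd.exists_quotient_obj_eq X
    refine ((RightFreyd.quotient V).map_comp _ _).symm.trans ?_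
    refine Eq.trans ?_ ((RightFreyd.quotient V).map_id _)
    congr 1
    ext
    · exact adj.right_triangle_components _
    · exact adj.right_triangle_components _

/-- Compatibility of `mapFreyd` with composition. -/
def mapFreydComp (G : V ⥤ V') (H : V' ⥤ V'') [G.Additive] [H.Additive] :
    mapFreyd G ⋙ mapFreyd H ≅ mapFreyd (G ⋙ H) :=
  Quotient.natIsoLift _ (Iso.refl _)

/-- `mapFreyd` extends the given functor. -/
def projCompMapFreyd (G : V ⥤ V') [G.Additive] (X : V) :
    (mapFreyd G).obj ((RightFreyd.proj V).obj X) ≅ (RightFreyd.proj V').obj (G.obj X) :=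
  (RightFreyd.quotient V').mapIso
    (Arrow.isoMk (f := G.mapArrow.obj (Arrow.mk (0 : X ⟶ X))) (g := Arrow.mk 0)
      (Iso.refl _) (Iso.refl _)
      (show 𝟙 (G.obj X) ≫ (0 : G.obj X ⟶ G.obj X) = G.map (0 : X ⟶ X) ≫ 𝟙 _ by simp))

/-- The candidate cokernel of `f : u ⟶ v` is the arrow `biprod.desc v.hom f.right` from `v.left ⊞
u.right` to `v.right`. This lemma and the next handle maps out of the image under `G` of such a
biproduct without splitting that image. -/
lemma biprod_desc_comp_eq [HasBinaryBiproducts V] (G : V ⥤ V') [G.Additive] {X Y Z : V}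
    (f : X ⟶ Z) (g : Y ⟶ Z) {T W : V'} {p : G.obj X ⟶ T} {q : G.obj Y ⟶ T} {r : G.obj Z ⟶ W}
    {w : T ⟶ W} (hp : p ≫ w = G.map f ≫ r) (hq : q ≫ w = G.map g ≫ r) :
    (G.map biprod.fst ≫ p + G.map biprod.snd ≫ q) ≫ w = G.map (biprod.desc f g) ≫ r := by
  rw [biprod.desc_eq, G.map_add, G.map_comp, G.map_comp, Preadditive.add_comp,
    Preadditive.add_comp, Category.assoc, Category.assoc, Category.assoc, Category.assoc, hp, hq]

lemma inl_comp_biprod_desc_eq [HasBinaryBiproducts V] (G : V ⥤ V') [G.Additive] {X : V} (Y : V)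
    {T : V'} (p : G.obj X ⟶ T) (q : G.obj Y ⟶ T) :
    G.map (biprod.inl : X ⟶ X ⊞ Y) ≫ (G.map biprod.fst ≫ p + G.map biprod.snd ≫ q) = p := by
  rw [Preadditive.comp_add, ← Category.assoc, ← Category.assoc, ← G.map_comp, ← G.map_comp,
    biprod.inl_fst, biprod.inl_snd, G.map_id, G.map_zero, Category.id_comp, zero_comp, add_zero]

/-- The null-homotopy `h` of the composite is the component of the factorization on the added
summand `u.right`. The factorization already holds for squares, before passing to homotopy classes.
-/
lemma exists_mapArrow_π_comp_eq [HasBinaryBiproducts V] (G : V ⥤ V') [G.Additive]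
    {u v : Arrow V} (f : u ⟶ v) {w : Arrow V'} (g : G.mapArrow.obj v ⟶ w)
    (H : Nonempty (Arrow.RightHomotopy (G.mapArrow.map f ≫ g) 0)) :
    ∃ d : G.mapArrow.obj (RightFreyd.Candidate.cokernel f) ⟶ w,
      G.mapArrow.map (RightFreyd.Candidate.π f) ≫ d = g := by
  obtain ⟨h, hh⟩ := H
  have hh : G.map f.right ≫ g.right = h ≫ w.hom := (sub_zero _).symm.trans hh
  have hg : g.left ≫ w.hom = G.map v.hom ≫ g.right := g.w
  refine ⟨Arrow.homMk (f := G.mapArrow.obj (RightFreyd.Candidate.cokernel f))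
    (G.map biprod.fst ≫ g.left + G.map biprod.snd ≫ h) g.right
    (biprod_desc_comp_eq G v.hom f.right hg hh.symm), ?_⟩
  ext
  · exact inl_comp_biprod_desc_eq G u.right g.left h
  · refine (congrArg (· ≫ g.right) (G.map_id v.right)).trans ?_
    exact Category.id_comp _

lemma mapFreyd_preservesFiniteColimits [HasBinaryBiproducts V] [HasZeroObject V]
    [HasZeroObject V'] [HasBinaryBiproducts V'] (G : V ⥤ V') [G.Additive] :
    PreservesFiniteColimits (mapFreyd G) := by
  have {X Y : RightFreyd V} (f : X ⟶ Y) : PreservesColimit (parallelPair f 0) (mapFreyd G) := by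
    obtain ⟨u, rfl⟩ := RightFreyd.exists_quotient_obj_eq X
    obtain ⟨v, rfl⟩ := RightFreyd.exists_quotient_obj_eq Y
    obtain ⟨f, rfl⟩ := (RightFreyd.quotient V).map_surjective f
    refine preservesColimit_of_preserves_colimit_cocone
      (RightFreyd.Candidate.isColimitCokernelCofork f) ?_
    refine (CokernelCofork.isColimitMapCoconeEquiv _ _).symm ?_
    have : Epi ((mapFreyd G).map (Cofork.π (RightFreyd.Candidate.cokernelCofork f))) := by
      have : IsIso (G.mapArrow.map (RightFreyd.Candidate.π f)).right :=
        inferInstanceAs (IsIso (G.map (𝟙 v.right)))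
      exact RightFreyd.epi_of_isIso_right (G.mapArrow.map (RightFreyd.Candidate.π f))
    refine CokernelCofork.IsColimit.ofπ' _
      (by rw [← Functor.map_comp, CokernelCofork.condition, Functor.map_zero]) fun {T} g hg => Nonempty.some ?_
    obtain ⟨w, rfl⟩ := RightFreyd.exists_quotient_obj_eq T
    obtain ⟨g, rfl⟩ := (RightFreyd.quotient V').map_surjective g
    obtain ⟨d, hd⟩ := exists_mapArrow_π_comp_eq G f g ((RightFreyd.quotient_map_eq_zero_iff _).1
      (((RightFreyd.quotient V').map_comp (G.mapArrow.map f) g).trans hg))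
    exact ⟨⟨(RightFreyd.quotient V').map d,
      ((RightFreyd.quotient V').map_comp (G.mapArrow.map (RightFreyd.Candidate.π f)) d).symm.trans
        (congrArg (RightFreyd.quotient V').map hd)⟩⟩
  have : HasFiniteCoproducts (RightFreyd V) := hasFiniteCoproducts_of_has_binary_and_initial
  have : HasCoequalizers (RightFreyd V) := Preadditive.hasCoequalizers_of_hasCokernels
  exact (mapFreyd G).preservesFiniteColimits_of_preservesCokernels

/-- The cancellation argument: `S` preserves limits as a right adjoint, hence so does `U ⋙ S`, and
the adjunction converts this into the universal property of the image cone under `U` tested on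
`R.obj X`. By `hX` that single test object suffices. -/
lemma mapFreyd_preservesLimitsOfShape {U R S : V ⥤ V} [U.Additive] [R.Additive] [S.Additive]
    (adj : R ⊣ S) (hS : IsSummandOfPower (U ⋙ S) S) {X : V}
    (hX : ∀ Z, IsSummandOfPower Z (R.obj X)) (J : Type*) [Category* J] :
    PreservesLimitsOfShape J (mapFreyd U) where
  preservesLimit {K} := ⟨fun {c} hc => IsLimitAt.nonempty_isLimit fun Z => by
    have : PreservesLimitsOfShape J (mapFreyd S) :=
      (mapFreydAdjunction adj).rightAdjoint_preservesLimits.preservesLimitsOfShape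
    have : PreservesLimitsOfShape J (mapFreyd U ⋙ mapFreyd S) :=
      ((IsSummandOfPower.of_iso (mapFreydComp U S)).trans hS.mapFreyd).preservesLimitsOfShape
    have hlim : IsLimit ((mapFreyd S).mapCone ((mapFreyd U).mapCone c)) :=
      isLimitOfPreserves (mapFreyd U ⋙ mapFreyd S) hc
    refine RightFreyd.isLimitAt_of_proj (fun Z => ?_) Z
    refine (IsLimitAt.of_adjunction (mapFreydAdjunction adj) hlim
      ((RightFreyd.proj V).obj X)).of_isSummandOfPower ?_
    exact ((hX Z).map (RightFreyd.proj V)).trans (.of_iso (projCompMapFreyd R X).symm)⟩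

end ProjectiveFunctors

end Freyd

/-! ### Summands of powers among the bimodules P ⊗ Q. -/

namespace AlgBimod

variable {k : Type uk} {A : Type u} [Field k] [Ring A] [Algebra k A]

/-- Composition of bimodule homomorphisms. -/
def Hom.comp {W V U : AlgBimod k A} (g : Hom V U) (f : Hom W V) : Hom W U where
  __ := g.toLinearMap ∘ₗ f.toLinearMap
  map_rsmul b w := (congrArg g.toLinearMap (f.map_rsmul b w)).trans (g.map_rsmul b _)

/-- `W` is a direct summand of a finite power of `V`. -/
def IsSummandOfPower (W V : AlgBimod k A) : Prop :=
  ∃ (ι : Type) (_ : Fintype ι) (i : ι → Hom W V) (p : ι → Hom V W),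
    ∀ w, ∑ a, (p a).toLinearMap ((i a).toLinearMap w) = w

namespace IsSummandOfPower

lemma of_retract {W V : AlgBimod k A} (i : Hom W V) (p : Hom V W)
    (h : ∀ w, p.toLinearMap (i.toLinearMap w) = w) : IsSummandOfPower W V :=
  ⟨Unit, inferInstance, fun _ => i, fun _ => p, by simpa using h⟩

lemma of_family {ι : Type} [Fintype ι] {W V : AlgBimod k A} (Y : ι → AlgBimod k A)
    (i : ∀ x, Hom W (Y x)) (p : ∀ x, Hom (Y x) W)
    (h : ∀ w, ∑ x, (p x).toLinearMap ((i x).toLinearMap w) = w)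
    (hY : ∀ x, IsSummandOfPower (Y x) V) : IsSummandOfPower W V := by
  choose κ hκ j q hjq using hY
  refine ⟨Σ a, κ a, inferInstance, fun x => (j x.1 x.2).comp (i x.1),
    fun x => (p x.1).comp (q x.1 x.2), fun w => ?_⟩
  rw [Fintype.sum_sigma]
  refine Eq.trans (Finset.sum_congr rfl fun a _ => ?_) (h w)
  exact (map_sum (p a).toLinearMap _ _).symm.trans (congrArg (p a).toLinearMap (hjq a ((i a).toLinearMap w)))

end IsSummandOfPower

section Outer

variable (k) {P Q P' Q' : Type u} [AddCommGroup P] [Module k P] [Module A P] [IsScalarTower k A P]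
  [AddCommGroup Q] [Module k Q] [Module Aᵐᵒᵖ Q] [IsScalarTower k Aᵐᵒᵖ Q]
  [AddCommGroup P'] [Module k P'] [Module A P'] [IsScalarTower k A P']
  [AddCommGroup Q'] [Module k Q'] [Module Aᵐᵒᵖ Q'] [IsScalarTower k Aᵐᵒᵖ Q']

/-- The bimodule homomorphism `f ⊗ g`. -/
noncomputable def outerMap₂ (f : P →ₗ[A] P') (g : Q →ₗ[Aᵐᵒᵖ] Q') :
    Hom (outer (k := k) (A := A) P Q) (outer P' Q') where
  __ := TensorProduct.AlgebraTensorModule.map f (g.restrictScalars k)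
  map_rsmul b z := DFunLike.congr_fun (outer_addHom_ext
    (f := (TensorProduct.AlgebraTensorModule.map f (g.restrictScalars k)).toAddMonoidHom.comp
      (DistribSMul.toAddMonoidHom (outer (k := k) (A := A) P Q) b))
    (g := (DistribSMul.toAddMonoidHom (outer (k := k) (A := A) P' Q') b).comp
      (TensorProduct.AlgebraTensorModule.map f (g.restrictScalars k)).toAddMonoidHom)
    fun p q => congrArg (f p ⊗ₜ[k] ·) (map_smul g b q)) z

lemma outerMap₂_comp_apply (f : P →ₗ[A] P') (g : Q →ₗ[Aᵐᵒᵖ] Q') (f' : P' →ₗ[A] P)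
    (g' : Q' →ₗ[Aᵐᵒᵖ] Q) (hf : ∀ p, f' (f p) = p) (hg : ∀ q, g' (g q) = q)
    (z : outer (k := k) (A := A) P Q) :
    (outerMap₂ k f' g').toLinearMap ((outerMap₂ k f g).toLinearMap z) = z :=
  DFunLike.congr_fun (outer_addHom_ext (k := k) (P := P) (Q := Q)
    (f := ((outerMap₂ k f' g').toLinearMap ∘ₗ (outerMap₂ k f g).toLinearMap).toAddMonoidHom)
    (g := AddMonoidHom.id _) fun p q => by
      change f' (f p) ⊗ₜ[k] g' (g q) = p ⊗ₜ[k] q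
      rw [hf, hg]) z

variable {k}

/-- The bilinear map `(p ⊗ q, p' ⊗ q') ↦ β(q, p') p ⊗ q'`. -/
noncomputable def contractAux (P Q' : Type u) [AddCommGroup P] [Module k P]
    [AddCommGroup Q'] [Module k Q'] (β : Q →ₗ[k] P' →ₗ[k] k) :
    P ⊗[k] Q →ₗ[k] P' ⊗[k] Q' →ₗ[k] P ⊗[k] Q' :=
  TensorProduct.lift (LinearMap.mk₂ k
    (fun p q => TensorProduct.mk k P Q' p ∘ₗ (TensorProduct.lid k Q').toLinearMap ∘ₗ
      (β q).rTensor Q')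
    (fun p p' q => by ext; simp)
    (fun c p q => by ext; simp [TensorProduct.smul_tmul'])
    (fun p q q' => by ext; simp [TensorProduct.tmul_add])
    (fun c p q => by ext; simp))

/-- The contraction `(P ⊗ Q) ⊗_A (P' ⊗ Q') → P ⊗ Q'` along a balanced pairing of `Q` and `P'`. -/
noncomputable def contraction (P Q' : Type u) [AddCommGroup P] [Module k P] [Module A P]
    [IsScalarTower k A P] [AddCommGroup Q'] [Module k Q'] [Module Aᵐᵒᵖ Q']
    [IsScalarTower k Aᵐᵒᵖ Q'] (β : Q →ₗ[k] P' →ₗ[k] k)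
    (hβ : ∀ (a : A) q p', β (MulOpposite.op a • q) p' = β q (a • p')) :
    Hom (tensor (outer (k := k) (A := A) P Q) (outer P' Q')) (outer P Q') :=
  let W := outer (k := k) (A := A) P Q
  let V := outer (k := k) (A := A) P' Q'
  let U := outer (k := k) (A := A) P Q'
  let f : W →+ V →+ U := LinearMap.toAddMonoidHom'.comp (contractAux P Q' β).toAddMonoidHom
  tensorHom (W := W) (V := V) (U := U) (tlift f
    (fun a w v => DFunLike.congr_fun (outer_addHom_ext (k := k) (P := P) (Q := Q)
      (f := (f.flip v).comp (DistribSMul.toAddMonoidHom W (MulOpposite.op a)))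
      (g := f.flip (a • v)) fun p q => DFunLike.congr_fun (outer_addHom_ext
        (k := k) (P := P') (Q := Q') (f := f (p ⊗ₜ[k] (MulOpposite.op a • q) : P ⊗[k] Q))
        (g := (f (p ⊗ₜ[k] q : P ⊗[k] Q)).comp (DistribSMul.toAddMonoidHom V a)) fun p' q' =>
          congrArg (fun c : k => p ⊗ₜ[k] (c • q')) (hβ a q p')) v) w)
    (fun a w v => DFunLike.congr_fun (outer_addHom_ext (k := k) (P := P) (Q := Q)
      (f := (f.flip v).comp (DistribSMul.toAddMonoidHom W a))
      (g := (DistribSMul.toAddMonoidHom U a).comp (f.flip v)) fun p q =>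
        DFunLike.congr_fun (outer_addHom_ext
        (k := k) (P := P') (Q := Q') (f := f ((a • p) ⊗ₜ[k] q : P ⊗[k] Q))
        (g := (DistribSMul.toAddMonoidHom U a).comp (f (p ⊗ₜ[k] q : P ⊗[k] Q)))
        fun _ _ => rfl) v) w))
    (fun b w v => DFunLike.congr_fun (outer_addHom_ext (k := k) (P := P) (Q := Q)
      (f := f.flip (b • v))
      (g := (DistribSMul.toAddMonoidHom U b).comp (f.flip v)) fun p q =>
        DFunLike.congr_fun (outer_addHom_ext
        (k := k) (P := P') (Q := Q') (f := (f (p ⊗ₜ[k] q : P ⊗[k] Q)).comp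
          (DistribSMul.toAddMonoidHom V b))
        (g := (DistribSMul.toAddMonoidHom U b).comp (f (p ⊗ₜ[k] q : P ⊗[k] Q)))
        fun p' q' => congrArg (p ⊗ₜ[k] ·) (smul_comm (β q p') b q')) v) w)

lemma tmk_smul_base {W V : AlgBimod k A} (c : k) (w : W) (v : V) :
    tmk W w (c • v) = c • tmk W w v := by
  rw [← algebraMap_smul A c v, ← algebraMap_smul A c (tmk W w v), ← tmk_rsmul, smul_tmk,
    ← MulOpposite.algebraMap_apply, algebraMap_smul, algebraMap_smul]

/-- The element `(p ⊗ q) ⊗ (p' ⊗ q')` of `(P ⊗ Q) ⊗_A (P' ⊗ Q')`. -/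
noncomputable def tmk₂ (p : P) (q : Q) (p' : P') (q' : Q') :
    tensor (outer (k := k) (A := A) P Q) (outer P' Q') :=
  tmk (outer (k := k) (A := A) P Q) (X := outer (k := k) (A := A) P' Q')
    (p ⊗ₜ[k] q : P ⊗[k] Q) (p' ⊗ₜ[k] q' : P' ⊗[k] Q')

lemma tmk₂_add (p : P) (q : Q) (p' : P') (x y : Q') :
    tmk₂ (k := k) (A := A) p q p' (x + y) = tmk₂ p q p' x + tmk₂ p q p' y :=
  (congrArg (fun z : P' ⊗[k] Q' => tmk (outer (k := k) (A := A) P Q)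
    (X := outer (k := k) (A := A) P' Q') (p ⊗ₜ[k] q : P ⊗[k] Q) z)
    (TensorProduct.tmul_add p' x y)).trans (tmk_add (W := outer (k := k) (A := A) P Q) _ _ _)

lemma add_tmk₂ (x y : P) (q : Q) (p' : P') (q' : Q') :
    tmk₂ (k := k) (A := A) (x + y) q p' q' = tmk₂ x q p' q' + tmk₂ y q p' q' :=
  (congrArg (fun z : P ⊗[k] Q => tmk (outer (k := k) (A := A) P Q)
    (X := outer (k := k) (A := A) P' Q') z (p' ⊗ₜ[k] q' : P' ⊗[k] Q'))
    (TensorProduct.add_tmul x y q)).trans (add_tmk (W := outer (k := k) (A := A) P Q) _ _ _)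

lemma tmk₂_smul (c : k) (p : P) (q : Q) (p' : P') (q' : Q') :
    tmk₂ (k := k) (A := A) p q p' (c • q') = c • tmk₂ p q p' q' :=
  (congrArg (fun z : P' ⊗[k] Q' => tmk (outer (k := k) (A := A) P Q)
    (X := outer (k := k) (A := A) P' Q') (p ⊗ₜ[k] q : P ⊗[k] Q) z)
    (TensorProduct.tmul_smul c p' q')).trans (tmk_smul_base c _ _)

lemma smul_tmk₂ (a : A) (p : P) (q : Q) (p' : P') (q' : Q') :
    tmk₂ (k := k) (A := A) (a • p) q p' q' = a • tmk₂ (k := k) (A := A) p q p' q' := rfl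

lemma contraction_tmk (β : Q →ₗ[k] P' →ₗ[k] k) (hβ) (p : P) (q : Q) (p' : P') (q' : Q') :
    (contraction (A := A) P Q' β hβ).toLinearMap
      (tmk₂ p q p' q') = (p ⊗ₜ[k] (β q p' • q') : P ⊗[k] Q') := rfl

/-- The map `p ⊗ q' ↦ (p ⊗ q) ⊗ (1 ⊗ q')`. -/
noncomputable def insertion (P Q' : Type u) [AddCommGroup P] [Module k P] [Module A P]
    [IsScalarTower k A P] [AddCommGroup Q'] [Module k Q'] [Module Aᵐᵒᵖ Q']
    [IsScalarTower k Aᵐᵒᵖ Q'] (q : Q) :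
    Hom (outer P Q') (tensor (outer (k := k) (A := A) P Q) (outer A Q')) :=
  let f : P ⊗[k] Q' →ₗ[A] tensor (outer (k := k) (A := A) P Q) (outer A Q') :=
    TensorProduct.AlgebraTensorModule.lift
    { toFun := fun p =>
        { toFun := fun q' => tmk₂ p q 1 q'
          map_add' := fun _ _ => tmk₂_add _ _ _ _ _
          map_smul' := fun _ _ => tmk₂_smul _ _ _ _ _ }
      map_add' := fun _ _ => LinearMap.ext fun _ => add_tmk₂ _ _ _ _ _
      map_smul' := fun _ _ => LinearMap.ext fun _ => smul_tmk₂ _ _ _ _ _ }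
  { f with
    map_rsmul := fun b z => DFunLike.congr_fun (outer_addHom_ext (k := k) (P := P) (Q := Q')
      (f := f.toAddMonoidHom.comp (DistribSMul.toAddMonoidHom (outer (k := k) (A := A) P Q') b))
      (g := (DistribSMul.toAddMonoidHom (tensor (outer (k := k) (A := A) P Q) (outer A Q'))
        b).comp f.toAddMonoidHom)
      fun _ _ => rfl) z }

lemma insertion_tmul (q : Q) (p : P) (q' : Q') :
    (insertion (k := k) (A := A) P Q' q).toLinearMap (p ⊗ₜ[k] q' : P ⊗[k] Q') =
      tmk₂ p q (1 : A) q' := rfl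

/-- The pairing `(q, a) ↦ l(qa)` of `Q` and `A`. -/
noncomputable def actionPairing (l : Q →ₗ[k] k) : Q →ₗ[k] A →ₗ[k] k :=
  LinearMap.mk₂ k (fun q a => l (MulOpposite.op a • q))
    (fun q q' a => by rw [smul_add, map_add])
    (fun c q a => by rw [smul_comm, map_smul])
    (fun q a b => by rw [MulOpposite.op_add, add_smul, map_add])
    (fun c q a => by rw [MulOpposite.op_smul, smul_assoc, map_smul])

lemma actionPairing_balanced (l : Q →ₗ[k] k) (a : A) (q : Q) (b : A) :
    actionPairing l (MulOpposite.op a • q) b = actionPairing l q (a • b) := by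
  change l (MulOpposite.op b • MulOpposite.op a • q) = l (MulOpposite.op (a * b) • q)
  rw [MulOpposite.op_mul, mul_smul]

variable (k P Q Q')

lemma contraction_insertion (l : Q →ₗ[k] k) (q : Q) (z : P ⊗[k] Q') :
    (contraction (A := A) P Q' (actionPairing l) (actionPairing_balanced l)).toLinearMap
      ((insertion P Q' q).toLinearMap z) = l q • z := by
  let L := (contraction (A := A) P Q' (actionPairing l) (actionPairing_balanced l)).toLinearMap ∘ₗ
    (insertion P Q' q).toLinearMap
  induction z using TensorProduct.induction_on with
  | zero => exact L.map_zero.trans (smul_zero (l q)).symm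
  | tmul p q' =>
    rw [insertion_tmul, contraction_tmk, TensorProduct.tmul_smul]
    refine congrArg (fun c : k => c • (p ⊗ₜ[k] q' : P ⊗[k] Q')) ?_
    change l (MulOpposite.op (1 : A) • q) = l q
    rw [MulOpposite.op_one, one_smul]
  | add y z hy hz =>
    exact (L.map_add y z).trans ((congrArg₂ (· + ·) hy hz).trans (smul_add (l q) y z).symm)

/-- Inserting `q` and then contracting with a functional `l` multiplies by `l q`; as `q` is
non-zero, `l` can be chosen with `l q = 1`. -/
lemma outer_isSummandOfPower_tensor (q : Q) (hq : q ≠ 0) :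
    IsSummandOfPower (outer P Q') (tensor (outer (k := k) (A := A) P Q) (outer A Q')) := by
  obtain ⟨l, hl⟩ := Module.Projective.exists_dual_eq_one k hq
  refine .of_retract (insertion P Q' q)
    (contraction P Q' (actionPairing l) (actionPairing_balanced l)) fun z => ?_
  refine (contraction_insertion k P Q Q' l q z).trans ?_
  rw [hl]
  exact one_smul k (z : P ⊗[k] Q')

lemma tensor_addHom_ext₂ {Z : Type*} [AddCommGroup Z]
    {f g : tensor (outer (k := k) (A := A) P Q) (outer (k := k) (A := A) P' Q') →+ Z}
    (h : ∀ p q p' q', f (tmk₂ p q p' q') = g (tmk₂ p q p' q')) : f = g :=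
  tensor_addHom_ext fun w v => DFunLike.congr_fun (outer_addHom_ext (k := k) (P := P) (Q := Q)
    (f := f.comp ((tmkHom (outer (k := k) (A := A) P Q)).flip v))
    (g := g.comp ((tmkHom (outer (k := k) (A := A) P Q)).flip v)) fun p q =>
      DFunLike.congr_fun (outer_addHom_ext (k := k) (P := P') (Q := Q')
      (f := f.comp (tmkHom (outer (k := k) (A := A) P Q) (p ⊗ₜ[k] q : P ⊗[k] Q)))
      (g := g.comp (tmkHom (outer (k := k) (A := A) P Q) (p ⊗ₜ[k] q : P ⊗[k] Q)))
      fun p' q' => h p q p' q') v) w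

/-- The left side is P ⊗ Q ⊗ Q', a sum of copies of P ⊗ Q' indexed by a basis of `Q`: contract with
the coordinate functionals and insert the basis vectors. -/
lemma tensor_outer_isSummandOfPower [Module.Finite k Q] :
    IsSummandOfPower (tensor (outer (k := k) (A := A) P Q) (outer A Q')) (outer P Q') := by
  let b := Module.finBasis k Q
  let W := outer (k := k) (A := A) P Q
  let V := outer (k := k) (A := A) A Q'
  let i (x) : Hom (tensor W V) (outer P Q') :=
    contraction P Q' (actionPairing (b.coord x)) (actionPairing_balanced (b.coord x))
  let p (x) : Hom (outer P Q') (tensor W V) := insertion P Q' (b x)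
  refine ⟨_, inferInstance, i, p, fun w => ?_⟩
  refine (LinearMap.sum_apply _ (fun x => (p x).toLinearMap ∘ₗ (i x).toLinearMap) w).symm.trans ?_
  refine DFunLike.congr_fun (tensor_addHom_ext₂ k P Q Q' (P' := A)
    (f := (∑ x, (p x).toLinearMap ∘ₗ (i x).toLinearMap).toAddMonoidHom) (g := AddMonoidHom.id _)
    fun r q a q' => ?_) w
  refine (LinearMap.sum_apply _ _ (tmk₂ r q a q')).trans ?_
  change ∑ x, tmk₂ r (b x) (1 : A) (b.coord x (MulOpposite.op a • q) • q') = tmk₂ r q a q'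
  have h1 (x) : tmk₂ (k := k) (A := A) r (b x) (1 : A) (b.coord x (MulOpposite.op a • q) • q') =
      tmk₂ r (b.repr (MulOpposite.op a • q) x • b x) 1 q' := by
    rw [tmk₂_smul]
    exact congrArg (fun z : P ⊗[k] Q => tmk W (X := V) z (1 ⊗ₜ[k] q' : A ⊗[k] Q'))
      (TensorProduct.tmul_smul _ _ _).symm
  simp only [h1]
  refine (map_sum ((tmkHom (X := V) W).flip (1 ⊗ₜ[k] q' : A ⊗[k] Q'))
    (fun x => (r ⊗ₜ[k] (b.repr (MulOpposite.op a • q) x • b x) : P ⊗[k] Q)) _).symm.trans ?_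
  rw [← TensorProduct.tmul_sum, b.sum_repr]
  -- The contraction moved `a` onto `q`; balancedness moves it back to the factor `A`.
  refine (tmk_rsmul (W := W) (X := V) a (r ⊗ₜ[k] q : P ⊗[k] Q) (1 ⊗ₜ[k] q' : A ⊗[k] Q')).trans ?_
  exact congrArg (fun c : A => tmk₂ (k := k) (A := A) r q c q') (mul_one a)

variable {k}

/-- Left tensoring with any 1-morphism keeps A ⊗ Q in its own additive closure: this is clear for
the generators A and A ⊗ A and passes to summands. It is used with Q = e_tA. -/
lemma isSummandOfPower_of_addClosure [Module.Finite k A] {W : AlgBimod k A}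
    (hW : AddClosure W) : IsSummandOfPower (tensor W (outer A Q)) (outer A Q) := by
  induction hW with
  | regular =>
    exact .of_retract (tensorHom (regularEquiv k (outer (k := k) (A := A) A Q)).toLinearMap
        fun b (a : A) v => (smul_comm a b v))
      { (regularEquiv k (outer (k := k) (A := A) A Q)).symm.toLinearMap with
        map_rsmul := fun _ _ => rfl }
      fun z => (regularEquiv k (outer (k := k) (A := A) A Q)).symm_apply_apply z
  | free => exact tensor_outer_isSummandOfPower k A A Q
  | @summand W m Y hY i p h ih =>
    let V := outer (k := k) (A := A) A Q
    let i' (x) : Hom (tensor W V) (tensor (Y x) V) :=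
      tensorHom (U := AlgBimod.tensor (Y x) V) (tmap (i x) LinearMap.id) fun _ _ _ => rfl
    let p' (x) : Hom (tensor (Y x) V) (tensor W V) :=
      tensorHom (U := AlgBimod.tensor W V) (tmap (p x) LinearMap.id) fun _ _ _ => rfl
    refine .of_family _ i' p' (fun w => ?_) ih
    refine (LinearMap.sum_apply _
      (fun x => (p' x).toLinearMap ∘ₗ (i' x).toLinearMap) w).symm.trans ?_
    refine DFunLike.congr_fun (tensor_addHom_ext (W := W) (X := V)
      (f := (∑ x, (p' x).toLinearMap ∘ₗ (i' x).toLinearMap).toAddMonoidHom)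
      (g := AddMonoidHom.id _) fun w v => ?_) w
    refine (LinearMap.sum_apply _ _ (tmk W w v)).trans ?_
    exact (map_sum ((tmkHom W).flip v) _ _).symm.trans (congrArg (tmk W · v) (h w))

end Outer

end AlgBimod

/-! ### Tensor functors and the adjunction given by a perfect pairing. -/

namespace AlgBimod

variable {k : Type uk} {A : Type u} [Field k] [Ring A] [Algebra k A]

/-- The natural transformation of tensor functors induced by a bimodule homomorphism. -/
noncomputable def tensorNat {W V : AlgBimod k A} (f : Hom W V) :
    W.tensorFunctor ⟶ V.tensorFunctor where
  app X := ModuleCat.ofHom (tmap f LinearMap.id)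
  naturality X Y g := by
    ext z
    exact LinearMap.congr_fun (tensor_hom_ext (f := tmap f LinearMap.id ∘ₗ tmap (Hom.id W) g.hom)
      (g := tmap (Hom.id V) g.hom ∘ₗ tmap f LinearMap.id) fun w x => rfl) z

lemma IsSummandOfPower.tensorFunctor {W V : AlgBimod k A} (h : AlgBimod.IsSummandOfPower W V) :
    _root_.IsSummandOfPower W.tensorFunctor V.tensorFunctor := by
  obtain ⟨ι, _, i, p, hip⟩ := h
  refine ⟨ι, inferInstance, fun a => tensorNat (i a), fun a => tensorNat (p a), ?_⟩
  ext X z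
  rw [NatTrans.app_sum, ModuleCat.hom_sum, LinearMap.sum_apply]
  induction z using tensor_induction (W := W) (X := X) with
  | h0 => exact (Finset.sum_eq_zero fun _ _ => map_zero _).trans (map_zero _).symm
  | hmk w x => exact (map_sum ((tmkHom W).flip x) _ _).symm.trans (congrArg (tmk W · x) (hip w))
  | hadd y z hy hz =>
    refine (Finset.sum_congr rfl fun _ _ => map_add _ y z).trans ?_
    rw [Finset.sum_add_distrib]
    exact (congrArg₂ (· + ·) hy hz).trans (map_add _ y z).symm

instance finite_tensor (W : AlgBimod k A) [Module.Finite A W] (X : Type u) [AddCommGroup X]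
    [Module A X] [Module.Finite A X] : Module.Finite A (Tensor W X) := by
  obtain ⟨s, hs⟩ := Module.Finite.fg_top (R := A) (M := W)
  obtain ⟨t, ht⟩ := Module.Finite.fg_top (R := A) (M := X)
  classical
  refine ⟨⟨Finset.image₂ (tmk W) s t, ?_⟩⟩
  rw [eq_top_iff]
  rintro z -
  induction z using tensor_induction with
  | h0 => exact zero_mem _
  | hadd y z hy hz => exact add_mem hy hz
  | hmk w x =>
    have hx : x ∈ Submodule.span A (t : Set X) := ht ▸ Submodule.mem_top
    induction hx using Submodule.span_induction generalizing w with
    | zero => rw [tmk_zero]; exact zero_mem _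
    | add x y _ _ hx hy => rw [tmk_add]; exact add_mem (hx w) (hy w)
    | smul a x _ hx => rw [← tmk_rsmul]; exact hx _
    | mem x hx =>
      have hw : w ∈ Submodule.span A (s : Set W) := hs ▸ Submodule.mem_top
      induction hw using Submodule.span_induction with
      | zero => rw [zero_tmk]; exact zero_mem _
      | add x y _ _ hx hy => rw [add_tmk]; exact add_mem hx hy
      | smul a x _ hx => rw [← smul_tmk]; exact Submodule.smul_mem _ _ hx
      | mem w hw =>
        refine Submodule.subset_span ?_
        rw [Finset.coe_image₂]
        exact Set.mem_image2_of_mem hw hx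

section Duality

variable {P Q : Type u} [AddCommGroup P] [Module k P] [Module A P] [IsScalarTower k A P]
  [AddCommGroup Q] [Module k Q] [Module Aᵐᵒᵖ Q] [IsScalarTower k Aᵐᵒᵖ Q]
  (Φ : P ≃ₗ[k] (Q →ₗ[k] k)) (hΦ : ∀ (a : A) p q, Φ (a • p) q = Φ p (MulOpposite.op a • q))

/-- The multiplication map `A ⊗ A → A`. -/
noncomputable def mulHom (k : Type uk) (A : Type u) [Field k] [Ring A] [Algebra k A] :
    Hom (outer (k := k) (A := A) A A) (regular k A) :=
  outerLift (V := regular k A) (U := regular k A) (AddMonoidHom.id _) fun _ _ => rfl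

/-- The evaluation `(A ⊗ Q) ⊗_A (P ⊗ A) → A`. -/
noncomputable def dualityCounit :
    Hom (tensor (outer (k := k) (A := A) A Q) (outer P A)) (regular k A) :=
  (mulHom k A).comp (contraction A A Φ.toLinearMap.flip fun a q p => (hΦ a p q).symm)

/-- The counit of the adjunction between `(A ⊗ Q) ⊗_A _` and `(P ⊗ A) ⊗_A _`. -/
noncomputable def tensorCounit : tensorFunctor (outer (k := k) (A := A) P A) ⋙
    tensorFunctor (outer (k := k) (A := A) A Q) ⟶ 𝟭 (ModuleCat.{u} A) :=
  (assocIso (outer (k := k) (A := A) A Q) (outer P A)).hom ≫ tensorNat (dualityCounit Φ hΦ) ≫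
    regularIso.hom

/-- The bilinear map `(p, q) ↦ (p ⊗ 1) ⊗ (1 ⊗ q)`. -/
noncomputable def coevalAux (P Q : Type u) [AddCommGroup P] [Module k P] [Module A P]
    [IsScalarTower k A P] [AddCommGroup Q] [Module k Q] [Module Aᵐᵒᵖ Q]
    [IsScalarTower k Aᵐᵒᵖ Q] : P →ₗ[k] Q →ₗ[k] tensor (outer (k := k) (A := A) P A) (outer A Q) :=
  LinearMap.mk₂ k (fun p q => tmk₂ p 1 1 q) (fun _ _ _ => add_tmk₂ _ _ _ _ _)
    (fun c p q => by
      rw [← algebraMap_smul A c p, smul_tmk₂, algebraMap_smul])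
    (fun _ _ _ => tmk₂_add _ _ _ _ _) (fun _ _ _ => tmk₂_smul _ _ _ _ _)

variable [Module.Finite k Q]

/-- The canonical element of `(P ⊗ A) ⊗_A (A ⊗ Q)`. -/
noncomputable def coeval : tensor (outer (k := k) (A := A) P A) (outer A Q) :=
  ∑ x, coevalAux P Q (Φ.symm ((Module.finBasis k Q).coord x)) (Module.finBasis k Q x)

lemma sum_dual_smul (p : P) :
    ∑ x, Φ p (Module.finBasis k Q x) • Φ.symm ((Module.finBasis k Q).coord x) = p := by
  apply Φ.injective
  rw [map_sum]
  simp only [map_smul, LinearEquiv.apply_symm_apply]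
  exact (Module.finBasis k Q).sum_dual_apply_smul_coord (Φ p)

include hΦ in
-- Under `Φ` the left action of `a` on `P` is the transpose of its right action on `Q`. Expanded in
-- a basis and its dual basis, both sides become the same double sum with the summations exchanged.
-- This centrality is what makes `dualityUnit` right linear.
lemma smul_coeval (a : A) : a • coeval (A := A) Φ = MulOpposite.op a • coeval (A := A) Φ := by
  let b := Module.finBasis k Q
  have h1 (x) : a • coevalAux (k := k) (A := A) P Q (Φ.symm (b.coord x)) (b x) =
      ∑ z, b.coord x (MulOpposite.op a • b z) •
        coevalAux (k := k) (A := A) P Q (Φ.symm (b.coord z)) (b x) := by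
    have h2 := sum_dual_smul Φ (a • Φ.symm (b.coord x))
    simp only [hΦ, LinearEquiv.apply_symm_apply] at h2
    refine (smul_tmk₂ (k := k) a (Φ.symm (b.coord x)) (1 : A) (1 : A) (b x)).symm.trans ?_
    change coevalAux (k := k) (A := A) P Q (a • Φ.symm (b.coord x)) (b x) = _
    rw [← h2, map_sum, LinearMap.sum_apply]
    simp only [map_smul, LinearMap.smul_apply]
    rfl
  have h3 (z) : MulOpposite.op a • coevalAux (k := k) (A := A) P Q (Φ.symm (b.coord z)) (b z) =
      ∑ x, b.coord x (MulOpposite.op a • b z) •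
        coevalAux (k := k) (A := A) P Q (Φ.symm (b.coord z)) (b x) := by
    change coevalAux (k := k) (A := A) P Q (Φ.symm (b.coord z)) (MulOpposite.op a • b z) = _
    simp only [← map_smul, ← map_sum]
    exact congrArg _ (b.sum_repr _).symm
  rw [coeval, Finset.smul_sum, Finset.smul_sum]
  exact (Finset.sum_congr rfl fun x _ => h1 x).trans
    (Finset.sum_comm.trans (Finset.sum_congr rfl fun x _ => (h3 x).symm))

/-- The coevaluation `A → (P ⊗ A) ⊗_A (A ⊗ Q)`. -/
noncomputable def dualityUnit :
    Hom (regular k A) (tensor (outer (k := k) (A := A) P A) (outer A Q)) where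
  __ := LinearMap.toSpanSingleton A _ (coeval Φ)
  map_rsmul b (a : A) := by
    change (a * b.unop) • coeval (A := A) Φ = b • a • coeval (A := A) Φ
    rw [mul_smul, smul_coeval Φ hΦ, smul_comm]
    rfl

/-- The unit of the adjunction between `(A ⊗ Q) ⊗_A _` and `(P ⊗ A) ⊗_A _`. -/
noncomputable def tensorUnit : 𝟭 (ModuleCat.{u} A) ⟶
    tensorFunctor (outer (k := k) (A := A) A Q) ⋙ tensorFunctor (outer (k := k) (A := A) P A) :=
  regularIso.inv ≫ tensorNat (dualityUnit Φ hΦ) ≫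
    (assocIso (outer (k := k) (A := A) P A) (outer A Q)).inv

lemma tensorUnit_apply (X : ModuleCat.{u} A) (x : X) :
    ((tensorUnit Φ hΦ).app X).hom x = ∑ z, tmk (outer (k := k) (A := A) P A)
      (Φ.symm ((Module.finBasis k Q).coord z) ⊗ₜ[k] (1 : A) : P ⊗[k] A)
      (tmk (outer (k := k) (A := A) A Q) ((1 : A) ⊗ₜ[k] Module.finBasis k Q z : A ⊗[k] Q) x) := by
  let W := outer (k := k) (A := A) P A
  let V := outer (k := k) (A := A) A Q
  have h1 : ((tensorUnit Φ hΦ).app X).hom x =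
      assocHom W V X (tmk (tensor W V) ((1 : A) • coeval Φ) x) := rfl
  rw [h1, one_smul]
  exact map_sum ((assocHom W V X).toAddMonoidHom.comp ((tmkHom (tensor W V)).flip x)) _ _

/-- A perfect balanced pairing of `P` and `Q` makes `(A ⊗ Q) ⊗_A _` left adjoint to
`(P ⊗ A) ⊗_A _`. -/
noncomputable def tensorAdjunction : tensorFunctor (outer (k := k) (A := A) A Q) ⊣
    tensorFunctor (outer (k := k) (A := A) P A) where
  unit := tensorUnit Φ hΦ
  counit := tensorCounit Φ hΦ
  left_triangle_components X := by
    let R := outer (k := k) (A := A) A Q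
    let b := Module.finBasis k Q
    let T : Tensor R X →ₗ[A] Tensor R X := ((tensorCounit Φ hΦ).app (R.tensorFunctor.obj X)).hom ∘ₗ
      (R.tensorFunctor.map ((tensorUnit Φ hΦ).app X)).hom
    refine ModuleCat.hom_ext (tensor_hom_ext (f := T) (g := LinearMap.id) fun w x =>
      DFunLike.congr_fun (outer_addHom_ext (k := k) (P := A) (Q := Q)
        (f := T.toAddMonoidHom.comp ((tmkHom R).flip x)) (g := (tmkHom R).flip x) fun a q => ?_) w)
    change ((tensorCounit Φ hΦ).app (R.tensorFunctor.obj X)).hom (tmk R (a ⊗ₜ[k] q : A ⊗[k] Q)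
      (((tensorUnit Φ hΦ).app X).hom x)) = tmk R (a ⊗ₜ[k] q : A ⊗[k] Q) x
    rw [tensorUnit_apply]
    refine (map_sum (((tensorCounit Φ hΦ).app
      (R.tensorFunctor.obj X)).hom.toAddMonoidHom.comp (tmkHom R (a ⊗ₜ[k] q : A ⊗[k] Q))) _
      _).trans ?_
    -- The left triangle identity reduces to the expansion of `q` in the basis `b`.
    have h1 (z) : (a * (Φ (Φ.symm (b.coord z)) q • (1 : A))) ⊗ₜ[k] b z =
        a ⊗ₜ[k] (b.repr q z • b z) := by
      rw [LinearEquiv.apply_symm_apply, mul_smul_comm, mul_one, TensorProduct.smul_tmul]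
      rfl
    refine Eq.trans (Finset.sum_congr rfl fun z _ => ?_)
      (map_sum ((tmkHom R).flip x) (fun z => (a ⊗ₜ[k] (b.repr q z • b z) : A ⊗[k] Q)) _).symm |>.trans ?_
    · refine Eq.trans ?_ (congrArg (fun w : A ⊗[k] Q => tmk R w x) (h1 z))
      refine Eq.trans ?_ (congrArg (fun c : A => tmk R (c ⊗ₜ[k] b z : A ⊗[k] Q) x) (mul_one _))
      rfl
    · rw [← TensorProduct.tmul_sum, b.sum_repr]
      rfl
  right_triangle_components Y := by
    let S := outer (k := k) (A := A) P A
    let b := Module.finBasis k Q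
    let T : Tensor S Y →ₗ[A] Tensor S Y := (S.tensorFunctor.map ((tensorCounit Φ hΦ).app Y)).hom ∘ₗ
      ((tensorUnit Φ hΦ).app (S.tensorFunctor.obj Y)).hom
    refine ModuleCat.hom_ext (tensor_hom_ext (f := T) (g := LinearMap.id) fun w y =>
      DFunLike.congr_fun (outer_addHom_ext (k := k) (P := P) (Q := A)
        (f := T.toAddMonoidHom.comp ((tmkHom S).flip y)) (g := (tmkHom S).flip y) fun p c => ?_) w)
    change (S.tensorFunctor.map ((tensorCounit Φ hΦ).app Y)).hom
      (((tensorUnit Φ hΦ).app (S.tensorFunctor.obj Y)).hom (tmk S (p ⊗ₜ[k] c : P ⊗[k] A) y)) =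
        tmk S (p ⊗ₜ[k] c : P ⊗[k] A) y
    refine (congrArg (S.tensorFunctor.map ((tensorCounit Φ hΦ).app Y)).hom
      (tensorUnit_apply Φ hΦ (S.tensorFunctor.obj Y)
        (tmk S (p ⊗ₜ[k] c : P ⊗[k] A) y))).trans ?_
    refine (map_sum (S.tensorFunctor.map ((tensorCounit Φ hΦ).app Y)).hom _ _).trans ?_
    -- The right triangle identity reduces to the expansion of `p` in the transported dual basis,
    -- `sum_dual_smul`.
    have h1 (z) : (Φ.symm (b.coord z)) ⊗ₜ[k] (1 * (1 * (Φ p (b z) • c))) =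
        (Φ p (b z) • Φ.symm (b.coord z)) ⊗ₜ[k] c := by
      rw [one_mul, one_mul, TensorProduct.smul_tmul]
    refine Eq.trans (Finset.sum_congr rfl fun z _ => ?_)
      (map_sum ((tmkHom S).flip y)
        (fun z => ((Φ p (b z) • Φ.symm (b.coord z)) ⊗ₜ[k] c : P ⊗[k] A)) _).symm |>.trans ?_
    · refine Eq.trans ?_ (congrArg (fun w : P ⊗[k] A => tmk S w y) (h1 z))
      refine Eq.trans ?_ (tmk_rsmul (W := S) (1 * (Φ p (b z) • c))
        (Φ.symm (b.coord z) ⊗ₜ[k] (1 : A) : P ⊗[k] A) y).symm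
      rfl
    · rw [← TensorProduct.sum_tmul, sum_dual_smul]
      rfl

end Duality

end AlgBimod

/-! ### Local endomorphism rings and idempotent retracts. -/

namespace IsSummandOfPower

lemma of_map {V : Type*} [Category* V] [Preadditive V] {V' : Type*} [Category* V']
    [Preadditive V'] (G : V ⥤ V') [G.Full] [G.Faithful] [G.Additive] {Z T : V}
    (h : IsSummandOfPower (G.obj Z) (G.obj T)) : IsSummandOfPower Z T := by
  obtain ⟨ι, _, i, p, hip⟩ := h
  refine ⟨ι, inferInstance, fun a => G.preimage (i a), fun a => G.preimage (p a), ?_⟩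
  apply G.map_injective
  simpa using hip

end IsSummandOfPower

/-- A decomposition gives idempotents `f` and `g` with sum 1. In a local ring one of them is a unit,
and a unit idempotent is 1, so the complementary summand vanishes. -/
lemma indecomposable_of_isLocalRing_end {V : Type*} [Category* V] [Preadditive V]
    [HasBinaryBiproducts V] {X : V} [IsLocalRing (End X)] : Indecomposable X := by
  refine ⟨fun h => one_ne_zero (α := End X) (h.eq_of_src _ _), fun Y Z e => ?_⟩
  let f : End X := e.hom ≫ biprod.fst ≫ biprod.inl ≫ e.inv
  let g : End X := e.hom ≫ biprod.snd ≫ biprod.inr ≫ e.inv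
  have hfg : f + g = 1 := by
    change e.hom ≫ _ + e.hom ≫ _ = 𝟙 X
    rw [← Preadditive.comp_add, ← Category.assoc, ← Category.assoc, ← Preadditive.add_comp,
      biprod.total, Category.id_comp, e.hom_inv_id]
  have hff : f * f = f := by
    change f ≫ f = f
    simp [f]
  have hgg : g * g = g := by
    change g ≫ g = g
    simp [g]
  rcases IsLocalRing.isUnit_or_isUnit_of_add_one hfg with h | h
  · right
    have h1 : f = 1 := h.mul_left_cancel (by rw [hff, mul_one])
    have h2 : (biprod.inr : Z ⟶ Y ⊞ Z) ≫ e.inv ≫ f ≫ e.hom ≫ biprod.snd = 0 := by simp [f]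
    rw [h1] at h2
    change (biprod.inr : Z ⟶ Y ⊞ Z) ≫ e.inv ≫ 𝟙 X ≫ e.hom ≫ biprod.snd = 0 at h2
    rw [IsZero.iff_id_eq_zero]
    simpa using h2
  · left
    have h1 : g = 1 := h.mul_left_cancel (by rw [hgg, mul_one])
    have h2 : (biprod.inl : Y ⟶ Y ⊞ Z) ≫ e.inv ≫ g ≫ e.hom ≫ biprod.fst = 0 := by simp [g]
    rw [h1] at h2
    change (biprod.inl : Y ⟶ Y ⊞ Z) ≫ e.inv ≫ 𝟙 X ≫ e.hom ≫ biprod.fst = 0 at h2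
    rw [IsZero.iff_id_eq_zero]
    simpa using h2

section IdempotentRetracts

variable {A : Type u} [Ring A]

/-- The retraction `a ↦ ae` of `A` onto `Ae`. -/
def leftProjRetraction (e : A) : A →ₗ[A] leftProj e :=
  (LinearMap.toSpanSingleton A A e).codRestrict _ fun a =>
    Submodule.smul_mem _ a (Submodule.mem_span_singleton_self e)

lemma leftProjRetraction_coe {e : A} (he : IsIdempotentElem e) (x : leftProj e) :
    leftProjRetraction e x = x := by
  obtain ⟨x, hx⟩ := x
  obtain ⟨a, rfl⟩ := Submodule.mem_span_singleton.1 hx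
  exact Subtype.ext ((mul_assoc a e e).trans (congrArg (a * ·) he))

/-- The retraction `a ↦ ea` of `A` onto `eA`. -/
def rightProjRetraction (e : A) : A →ₗ[Aᵐᵒᵖ] rightProj e where
  toFun a := ⟨e * a, Submodule.smul_mem _ (MulOpposite.op a) (Submodule.mem_span_singleton_self e)⟩
  map_add' a b := Subtype.ext (mul_add e a b)
  map_smul' b a := Subtype.ext (mul_assoc e a b.unop).symm

lemma rightProjRetraction_coe {e : A} (he : IsIdempotentElem e) (x : rightProj e) :
    rightProjRetraction e x = x := by
  obtain ⟨x, hx⟩ := x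
  obtain ⟨a, rfl⟩ := Submodule.mem_span_singleton.1 hx
  exact Subtype.ext ((mul_assoc e e a.unop).symm.trans (congrArg (· * a.unop) he))

end IdempotentRetracts

namespace AlgBimod

variable {k : Type uk} {A : Type u} [Field k] [Ring A] [Algebra k A]

lemma addClosure_outer_right {e : A} (he : IsIdempotentElem e) :
    AddClosure (outer (k := k) (A := A) A (rightProj e)) :=
  AddClosure.free.of_retract (outerMap₂ k LinearMap.id (rightProj e).subtype)
    (outerMap₂ k LinearMap.id (rightProjRetraction e))
    (outerMap₂_comp_apply k _ _ _ _ (fun _ => rfl) (rightProjRetraction_coe he))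

lemma addClosure_outer_left {e : A} (he : IsIdempotentElem e) :
    AddClosure (outer (k := k) (A := A) (leftProj e) A) :=
  AddClosure.free.of_retract (outerMap₂ k (leftProj e).subtype LinearMap.id)
    (outerMap₂ k (leftProjRetraction e) LinearMap.id)
    (outerMap₂_comp_apply k _ _ _ _ (leftProjRetraction_coe he) (fun _ => rfl))

lemma outer_proj_isSummandOfPower {e f : A} (he : IsIdempotentElem e) (hf : IsIdempotentElem f) :
    IsSummandOfPower (outer (k := k) (A := A) (leftProj e) (rightProj f)) (outer A A) :=
  .of_retract (outerMap₂ k (leftProj e).subtype (rightProj f).subtype)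
    (outerMap₂ k (leftProjRetraction e) (rightProjRetraction f))
    (outerMap₂_comp_apply k _ _ _ _ (leftProjRetraction_coe he) (rightProjRetraction_coe hf))

/-- Needed for tensoring with `W` to preserve finitely generated modules, and thus to define an
endofunctor of `C`. -/
lemma AddClosure.finite [Module.Finite k A] {W : AlgBimod k A} (hW : AddClosure W) :
    Module.Finite A W := by
  induction hW with
  | regular => exact inferInstanceAs (Module.Finite A A)
  | free => exact inferInstanceAs (Module.Finite A (A ⊗[k] A))
  | @summand W m Y hY i p h ih =>
    refine Module.Finite.of_surjective
      (∑ x, (p x).toLinearMap ∘ₗ LinearMap.proj (φ := fun x => (Y x : Type u)) x) fun w => ?_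
    exact ⟨fun x => (i x).toLinearMap w, (LinearMap.sum_apply _ _ _).trans (h w)⟩

end AlgBimod

/-! ### From bimodules to 1-morphisms and their action. -/

namespace ProjectiveFunctors

section OneMorphisms

variable {k : Type uk} {A : Type u} [Field k] [Ring A] [Algebra k A]
  {C : Type uC} [Category.{vC} C] (E : C ≌ FGModuleCat.{u} A)

/-- An endofunctor of `C` isomorphic to tensoring with `W`. -/
noncomputable def tensoringFunctor (W : AlgBimod k A) [Module.Finite A W] : C ⥤ C :=
  E.functor ⋙ (ModuleCat.isFG A).lift ((ModuleCat.isFG A).ι ⋙ W.tensorFunctor) (fun X => by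
    have : Module.Finite A X.obj := X.property
    exact AlgBimod.finite_tensor W X.obj) ⋙ E.inverse

lemma isTensoringWith_tensoringFunctor (W : AlgBimod k A) [Module.Finite A W] :
    IsTensoringWith E (tensoringFunctor E W) W :=
  ⟨Functor.isoWhiskerLeft (E.functor ⋙ (ModuleCat.isFG A).lift
    ((ModuleCat.isFG A).ι ⋙ W.tensorFunctor) _)
      (Functor.isoWhiskerRight E.counitIso (ModuleCat.isFG A).ι)⟩

lemma exists_oneMorphism [Module.Finite k A] {W : AlgBimod k A} (hW : W.AddClosure) :
    ∃ G : OneMorphism k E, IsTensoringWith E G.obj W :=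
  have := hW.finite
  ⟨⟨tensoringFunctor E W, W, hW, isTensoringWith_tensoringFunctor E W⟩,
    isTensoringWith_tensoringFunctor E W⟩

variable {E}

lemma IsTensoringWith.comp {G H : C ⥤ C} {W V : AlgBimod k A} (hG : IsTensoringWith E G W)
    (hH : IsTensoringWith E H V) : IsTensoringWith E (G ⋙ H) (V.tensor W) := by
  obtain ⟨α⟩ := hG
  obtain ⟨β⟩ := hH
  exact ⟨Functor.associator _ _ _ ≪≫ Functor.isoWhiskerLeft G β ≪≫
    (Functor.associator _ _ _).symm ≪≫ Functor.isoWhiskerRight α V.tensorFunctor ≪≫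
    Functor.associator _ _ _ ≪≫ Functor.isoWhiskerLeft _ (AlgBimod.assocIso V W)⟩

lemma IsTensoringWith.exists_adjunction {G H : C ⥤ C} {W V : AlgBimod k A}
    (hG : IsTensoringWith E G W) (hH : IsTensoringWith E H V)
    (adj : W.tensorFunctor ⊣ V.tensorFunctor) : Nonempty (G ⊣ H) := by
  obtain ⟨α⟩ := hG
  obtain ⟨β⟩ := hH
  have h := Functor.FullyFaithful.ofFullyFaithful (E.functor ⋙ (ModuleCat.isFG A).ι)
  exact ⟨adj.restrictFullyFaithful h h α.symm β.symm⟩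

/-- All natural transformations are 2-morphisms, and composing with the fully faithful functor from
`C` to modules is fully faithful on functor categories. Summand data between the tensor functors on
modules therefore lift to 1-morphisms. -/
lemma IsTensoringWith.isSummandOfPower [Preadditive C] [E.functor.Additive]
    {G H : OneMorphism k E} {W V : AlgBimod k A} (hG : IsTensoringWith E G.obj W)
    (hH : IsTensoringWith E H.obj V) (h : W.IsSummandOfPower V) : IsSummandOfPower G H := by
  obtain ⟨α⟩ := hG
  obtain ⟨β⟩ := hH
  let L := E.functor ⋙ (ModuleCat.isFG A).ι
  refine .of_map (isOneMorphism k E).ι (.of_map ((Functor.whiskeringRight C C _).obj L) ?_)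
  exact (IsSummandOfPower.of_iso α).trans
    ((h.tensorFunctor.map ((Functor.whiskeringLeft C _ _).obj L)).trans (.of_iso β.symm))

/-- An adjunction of functors is an adjunction in the 2-category of projective functors. -/
def oneMorphismAdjunction [Module.Finite k A] {G H : OneMorphism k E} (adj : G.obj ⊣ H.obj) :
    Bicategory.Adjunction (B := CA k E) (a := .pt) (b := .pt) G H where
  unit := ⟨adj.unit⟩
  counit := ⟨adj.counit⟩
  left_triangle := oneMorphism_hom_ext fun X => by
    simp only [Bicategory.leftZigzag, bicategoricalComp, BicategoricalCoherence.assoc_iso,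
      BicategoricalCoherence.whiskerRight_iso, BicategoricalCoherence.refl_iso, Iso.trans_hom,
      Bicategory.whiskerRightIso_hom, Iso.refl_hom, Bicategory.whiskerRight_comp,
      Bicategory.id_whiskerRight, Category.id_comp, Iso.inv_hom_id, Category.comp_id]
    change G.obj.map (adj.unit.app X) ≫ 𝟙 _ ≫ adj.counit.app (G.obj.obj X) = 𝟙 _ ≫ 𝟙 _
    simp
  right_triangle := oneMorphism_hom_ext fun X => by
    simp only [Bicategory.rightZigzag, bicategoricalComp, BicategoricalCoherence.assoc'_iso,
      BicategoricalCoherence.whiskerRight_iso, BicategoricalCoherence.refl_iso, Iso.trans_hom,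
      Bicategory.whiskerRightIso_hom, Iso.refl_hom, Bicategory.whiskerRight_comp,
      Bicategory.id_whiskerRight, Category.id_comp, Iso.inv_hom_id, Iso.symm_hom]
    change adj.unit.app (H.obj.obj X) ≫ 𝟙 _ ≫ H.obj.map (adj.counit.app X) = 𝟙 _ ≫ 𝟙 _
    simp

end OneMorphisms

namespace FinitaryTwoRep

attribute [local instance] hasBinaryBiproducts_of_finite_biproducts

variable {k : Type uk} {A : Type u} [Field k] [Ring A] [Algebra k A] [Module.Finite k A]
  {C : Type uC} [Category.{vC} C] [Preadditive C] [Linear k C] {E : C ≌ FGModuleCat.{u} A}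
  (M : FinitaryTwoRep.{uk, u, vC, uC, v, w} k E)

/-- The action of 1-morphisms and 2-morphisms. -/
def action : OneMorphism k E ⥤ (M.category ⥤ M.category) where
  obj G := M.functor G
  map α := (M.act.map₂ (a := .pt) (b := .pt) α).toNatTrans
  map_id G := congrArg (·.toNatTrans) (M.act.map₂_id (a := .pt) (b := .pt) G)
  map_comp α β := congrArg (·.toNatTrans) (M.act.map₂_comp (a := .pt) (b := .pt) α β)

instance : M.action.Additive where
  map_add {_ _ α β} := M.map₂_add α β

lemma functor_isSummandOfPower {G H : OneMorphism k E} (h : IsSummandOfPower G H) :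
    IsSummandOfPower (M.functor G) (M.functor H) :=
  h.map M.action

/-- The composite of 1-morphisms. -/
abbrev compOneMorphism (G H : OneMorphism k E) : OneMorphism k E :=
  ⟨G.obj ⋙ H.obj, isOneMorphism_comp G.property H.property⟩

/-- Compatibility of the action with composition. -/
def functorComp (G H : OneMorphism k E) :
    M.functor (compOneMorphism G H) ≅ M.functor G ⋙ M.functor H :=
  eqToIso (congrArg (·.toFunctor) (M.act.map_comp (a := .pt) (b := .pt) (c := .pt) G H))

/-- The adjunction between the actions of adjoint 1-morphisms. -/
def functorAdjunction {G H : OneMorphism k E} (adj : G.obj ⊣ H.obj) :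
    M.functor G ⊣ M.functor H :=
  .ofCat (M.act.mapAdjunction (oneMorphismAdjunction adj))

/-- By `hR`, applying any 1-morphism to R(X) gives a summand of a power of R(X) again. An
indecomposable summand of R(X) reaches every indecomposable by transitivity, and the Krull-Schmidt
property gives all objects. -/
lemma isSummandOfPower_obj (hM : M.IsTransitive) {R : OneMorphism k E}
    (hR : ∀ G, IsSummandOfPower (compOneMorphism R G) R) {X : M.category}
    (hX : ¬IsZero ((M.functor R).obj X)) (Z : M.category) :
    IsSummandOfPower Z ((M.functor R).obj X) := by
  obtain ⟨n, Y, hY, ⟨e⟩⟩ := M.krullSchmidt ((M.functor R).obj X)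
  -- An empty decomposition would make R(X) zero.
  obtain ⟨i⟩ : Nonempty (Fin n) := by
    by_contra hn
    rw [not_nonempty_iff] at hn
    refine hX (IsZero.of_iso ?_ e)
    rw [IsZero.iff_id_eq_zero]
    exact biproduct.hom_ext _ _ fun j => hn.elim j
  have key {Y' : M.category} (hY' : IsLocalRing (End Y')) :
      IsSummandOfPower Y' ((M.functor R).obj X) := by
    have := hY i
    obtain ⟨G, ⟨r⟩⟩ := hM (Y i) Y' indecomposable_of_isLocalRing_end
      indecomposable_of_isLocalRing_end
    refine (IsSummandOfPower.of_retract r.i r.r r.retract).trans ?_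
    have h1 : IsSummandOfPower (Y i) ((M.functor R).obj X) :=
      .of_retract (biproduct.ι Y i ≫ e.inv) (e.hom ≫ biproduct.π Y i) (by simp)
    refine (h1.map (M.functor G)).trans ?_
    refine (IsSummandOfPower.of_iso ((M.functorComp R G).symm.app X)).trans ?_
    exact (M.functor_isSummandOfPower (hR G)).app X
  obtain ⟨m, Y', hY', ⟨e'⟩⟩ := M.krullSchmidt Z
  refine (IsSummandOfPower.of_iso e').trans ?_
  exact .of_family Y' (biproduct.π Y') (biproduct.ι Y') biproduct.total fun a => key (hY' a)

end FinitaryTwoRep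

end ProjectiveFunctors

theorem proposition5 {k : Type uk} [Field k] [IsAlgClosed k]
    {A : Type u} [Ring A] [Algebra k A] [Module.Finite k A]
    (hconn : IsConnectedRing A) (hbasic : IsBasic A)
    {C : Type uC} [Category.{vC} C] [Preadditive C] [Linear k C]
    (E : C ≌ FGModuleCat.{u} A) [E.functor.Additive] [E.functor.Linear k]
    {n : ℕ} (e : Fin n → A) (he : IsPrimitiveDecomposition e)
    (hproj : ∃ s t, ProjIsoInj k (e s) (e t))
    (M : FinitaryTwoRep.{uk, u, vC, uC, v, w} k E) (hM : M.IsSimpleTransitive)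
    (Fij : Fin n → Fin n → OneMorphism k E)
    (hFij : ∀ i j, IsTensoringWith E (Fij i j).obj
      (AlgBimod.outer (k := k) (leftProj (e i)) (rightProj (e j))))
    (F : Bicone fun p : Fin n × Fin n => Fij p.1 p.2) (hF : F.IsBilimit) :
    exactFunctor M.Abelianization M.Abelianization (M.abelianizedFunctor F.pt) := by
  obtain ⟨s, t, Φ, hΦ⟩ := hproj
  have hidem (i) : IsIdempotentElem (e i) := (he.primitive i).1
  have hfin : Module.Finite k (rightProj (e t)) :=
    .of_injective ((rightProj (e t)).subtype.restrictScalars k) Subtype.val_injective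
  -- The non-zero vector of e_tA that splits A ⊗ A off (A ⊗ e_tA) ⊗_A (A ⊗ A) in `hUR`.
  have ht : (⟨e t, Submodule.mem_span_singleton_self _⟩ : rightProj (e t)) ≠ 0 := fun h =>
    (he.primitive t).2.1 (congrArg Subtype.val h)
  obtain ⟨U, hU⟩ := exists_oneMorphism E (AlgBimod.AddClosure.free (k := k) (A := A))
  obtain ⟨R, hR⟩ := exists_oneMorphism E (AlgBimod.addClosure_outer_right (k := k) (hidem t))
  obtain ⟨S, hS⟩ := exists_oneMorphism E (AlgBimod.addClosure_outer_left (k := k) (hidem s))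
  obtain ⟨adj⟩ := hR.exists_adjunction hS (AlgBimod.tensorAdjunction Φ hΦ)
  have hFU : IsSummandOfPower F.pt U := .of_isBilimit hF fun p =>
    (hFij p.1 p.2).isSummandOfPower hU
      (AlgBimod.outer_proj_isSummandOfPower (hidem p.1) (hidem p.2))
  have hUS : IsSummandOfPower (M.functor U ⋙ M.functor S) (M.functor S) :=
    (IsSummandOfPower.of_iso (M.functorComp U S).symm).trans <| M.functor_isSummandOfPower <|
      IsTensoringWith.isSummandOfPower (hU.comp hS) hS
        (AlgBimod.tensor_outer_isSummandOfPower k (leftProj (e s)) A A)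
  have hUR : IsSummandOfPower (M.functor U) (M.functor U ⋙ M.functor R) :=
    (M.functor_isSummandOfPower <| hU.isSummandOfPower (IsTensoringWith.comp hU hR)
      (AlgBimod.outer_isSummandOfPower_tensor k A (rightProj (e t)) A _ ht)).trans
        (.of_iso (M.functorComp U R))
  have hRG (G : OneMorphism k E) : IsSummandOfPower (FinitaryTwoRep.compOneMorphism R G) R := by
    obtain ⟨W, hW, hG⟩ := G.property
    exact IsTensoringWith.isSummandOfPower (hR.comp hG) hR
      (AlgBimod.isSummandOfPower_of_addClosure (rightProj (e t)) hW)
  have hlim (J : Type) [SmallCategory J] :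
      PreservesLimitsOfShape J (M.abelianizedFunctor F.pt) := by
    have : PreservesLimitsOfShape J (mapFreyd (M.functor U)) := by
      by_cases h0 : ∀ X, IsZero ((M.functor U).obj X)
      · have : PreservesLimitsOfShape J (mapFreyd (M.functor S)) := (mapFreydAdjunction
          (M.functorAdjunction adj)).rightAdjoint_preservesLimits.preservesLimitsOfShape
        -- A zero functor is a summand of every functor; `S` serves because it induces a
        -- limit-preserving one.
        exact (IsSummandOfPower.of_isZero (M.functor S)
          (Functor.isZero _ h0)).mapFreyd.preservesLimitsOfShape
      · push Not at h0
        obtain ⟨X, hX⟩ := h0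
        -- The test object is R(U(X)): by `hUR`, U(X) is a summand of a power of it, so it cannot
        -- vanish.
        have hX' : ¬IsZero ((M.functor R).obj ((M.functor U).obj X)) := fun h =>
          hX ((hUR.app X).isZero h)
        exact mapFreyd_preservesLimitsOfShape (M.functorAdjunction adj) hUS
          (M.isSummandOfPower_obj hM.transitive hRG hX') J
    exact (M.functor_isSummandOfPower hFU).mapFreyd.preservesLimitsOfShape
  have := hasBinaryBiproducts_of_finite_biproducts M.category
  have : HasZeroObject M.category := hasZeroObject_of_hasFiniteBiproducts _
  exact ⟨⟨fun J _ _ => hlim J⟩, mapFreyd_preservesFiniteColimits _⟩
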